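/- Let $1\le k\le d$ be integers. For $f\in L^1(\mathbb R^d)$ the partial Fourier transform in the first $k$ variables is $$\mathcal F_k f(\omega_1,\omega_2)=\int_{\mathbb R^k} f(x_1,\omega_2)\,e^{-2\pi i\,\omega_1\cdot x_1}\,dx_1,\qquad (\omega_1,\omega_2)\in\mathbb R^k\times\mathbb R^{d-k},$$ and $\mathcal F_k$ also denotes its unitary extension to $L^2(\mathbb R^d)$ (for $k=d$ this is the usual Fourier transform). Let $f\in L^2(\mathbb R^d)$ and suppose that there is a real number $N$ with $0\le N\le k$ such that $$\int_{\mathbb R^{2d}}\frac{|f(x)\,\mathcal F_k f(\omega)|}{(1+\|x\|+\|\omega\|)^N}\,e^{2\pi|x\cdot\omega|}\,dx\,d\omega<\infty,$$ where $\|\cdot\|$ is the Euclidean norm. Then $f=0$ almost everywhere. -/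

import Mathlib

open MeasureTheory
open scoped SchwartzMap

noncomputable section

/-- The space `ℝᵈ` with its Euclidean norm and inner product. -/
abbrev RSpace (d : ℕ) : Type := EuclideanSpace ℝ (Fin d)

/-- The space of the first `k` coordinates of `ℝᵈ`, a copy of `ℝᵏ` when `k ≤ d`. -/
abbrev HeadSpace (d k : ℕ) : Type := EuclideanSpace ℝ {i : Fin d // (i : ℕ) < k}

/-- The block `ω₁ = (ω 0, …, ω (k - 1))` of the first `k` coordinates of `ω = (ω₁, ω₂)`. -/
def headPart {d : ℕ} (k : ℕ) (ω : RSpace d) : HeadSpace d k :=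
  WithLp.toLp 2 fun i => ω i.1

/-- The point `(y, ω₂)` obtained from `ω = (ω₁, ω₂)` by replacing its first `k` coordinates
by `y`. -/
def replaceHead {d : ℕ} (k : ℕ) (y : HeadSpace d k) (ω : RSpace d) : RSpace d :=
  WithLp.toLp 2 fun i => if h : (i : ℕ) < k then y ⟨i, h⟩ else ω i

/-- The partial Fourier integral in the first `k` variables:
`ω = (ω₁, ω₂) ↦ ∫ f (y, ω₂) e^{-2π i ω₁ · y} dy`. -/
def partialFourierIntegral {d : ℕ} (k : ℕ) (f : RSpace d → ℂ) (ω : RSpace d) : ℂ :=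
  ∫ y : HeadSpace d k,
    f (replaceHead k y ω) *
      Complex.exp (-(2 * (Real.pi : ℂ) * Complex.I * ((inner ℝ (headPart k ω) y : ℝ) : ℂ)))

theorem lintegral_eq_lintegral_replaceHead {d : ℕ} (k : ℕ) (G : RSpace d → ENNReal)
    (hG : Measurable G) :
    ∫⁻ ω, G ω = ∫⁻ x₂ : {i : Fin d // ¬ (i : ℕ) < k} → ℝ, ∫⁻ y : HeadSpace d k,
      G (replaceHead k y (WithLp.toLp 2 fun i => if h : (i : ℕ) < k then 0 else x₂ ⟨i, h⟩)) := by
  have h1 := PiLp.volume_preserving_toLp (Fin d)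
  have h2 := (volume_preserving_piEquivPiSubtypeProd (fun _ : Fin d => ℝ)
    (fun i : Fin d => (i : ℕ) < k)).symm
  have h3 := PiLp.volume_preserving_toLp {i : Fin d // (i : ℕ) < k}
  have hG' : Measurable fun x : Fin d → ℝ => G (WithLp.toLp 2 x) := hG.comp h1.measurable
  rw [← h1.lintegral_comp hG, ← h2.lintegral_comp hG',
    Measure.volume_eq_prod]
  refine (lintegral_prod_symm' _ (hG'.comp h2.measurable)).trans ?_
  refine lintegral_congr fun x₂ => ?_
  rw [← h3.lintegral_comp]
  · refine lintegral_congr fun y => congrArg G ?_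
    ext i
    by_cases h : (i : ℕ) < k <;>
      simp [replaceHead, h, MeasurableEquiv.piEquivPiSubtypeProd, Equiv.piEquivPiSubtypeProd]
  · refine hG.comp ?_
    refine (WithLp.measurable_toLp 2 _).comp (measurable_pi_lambda _ fun i => ?_)
    by_cases h : (i : ℕ) < k
    · simp only [h, dif_pos]; fun_prop
    · simp only [h, dif_neg, not_false_eq_true]; fun_prop

theorem continuous_replaceHead {d : ℕ} (k : ℕ) :
    Continuous fun p : RSpace d × HeadSpace d k => replaceHead k p.2 p.1 := by
  refine (PiLp.continuous_toLp 2 _).comp (continuous_pi fun i => ?_)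
  by_cases h : (i : ℕ) < k
  · simp only [h, dif_pos]; fun_prop
  · simp only [h, dif_neg, not_false_eq_true]; fun_prop

theorem measurable_partialFourierIntegral {d : ℕ} (k : ℕ) (φ : 𝓢(RSpace d, ℂ)) :
    StronglyMeasurable (partialFourierIntegral k φ) := by
  have hc : Continuous fun p : RSpace d × HeadSpace d k =>
      φ (replaceHead k p.2 p.1) * Complex.exp (-(2 * (Real.pi : ℂ) * Complex.I *
        ((inner ℝ (headPart k p.1) p.2 : ℝ) : ℂ))) := by
    have hh : Continuous fun ω : RSpace d => headPart k ω :=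
      (PiLp.continuous_toLp 2 _).comp (continuous_pi fun i => by fun_prop)
    have := φ.continuous.comp (continuous_replaceHead (d := d) k)
    refine this.mul (Complex.continuous_exp.comp (Continuous.neg (continuous_const.mul
      (Complex.continuous_ofReal.comp ?_))))
    exact (hh.comp continuous_fst).inner continuous_snd
  exact hc.stronglyMeasurable.integral_prod_right

/-- The restriction `y ↦ φ (y, ω₂)` of a Schwartz function is a Schwartz function. -/
theorem exists_schwartz_slice {d : ℕ} (k : ℕ) (φ : 𝓢(RSpace d, ℂ)) (ω : RSpace d) :
    ∃ ψ : 𝓢(HeadSpace d k, ℂ), ∀ y, ψ y = φ (replaceHead k y ω) := by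
  let L : HeadSpace d k →ₗ[ℝ] RSpace d :=
    { toFun := fun y => replaceHead k y 0
      map_add' := fun x y => by
        ext i; by_cases h : (i : ℕ) < k <;> simp [replaceHead, h]
      map_smul' := fun c y => by
        ext i; by_cases h : (i : ℕ) < k <;> simp [replaceHead, h] }
  have hL : ∀ y, replaceHead k y ω = LinearMap.toContinuousLinearMap L y +
      replaceHead k 0 ω := fun y => by
    ext i; by_cases h : (i : ℕ) < k <;> simp [L, replaceHead, h]
  have hg : (fun y => replaceHead k y ω).HasTemperateGrowth := by
    rw [funext hL]
    exact (ContinuousLinearMap.hasTemperateGrowth _).add (.const _)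
  have ha : AntilipschitzWith 1 (fun y => replaceHead k y ω) := by
    refine AntilipschitzWith.of_le_mul_dist fun x y => ?_
    rw [NNReal.coe_one, one_mul, EuclideanSpace.dist_eq, EuclideanSpace.dist_eq]
    refine Real.sqrt_le_sqrt ?_
    calc ∑ j : {i : Fin d // (i : ℕ) < k}, dist (x j) (y j) ^ 2
        = ∑ j : {i : Fin d // (i : ℕ) < k},
            dist (replaceHead k x ω j.1) (replaceHead k y ω j.1) ^ 2 :=
          Finset.sum_congr rfl fun j _ => by simp [replaceHead, j.2]
      _ = ∑ i ∈ Finset.univ.filter fun i : Fin d => (i : ℕ) < k,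
            dist (replaceHead k x ω i) (replaceHead k y ω i) ^ 2 :=
          (Finset.sum_subtype _ (by simp)
            fun i => dist (replaceHead k x ω i) (replaceHead k y ω i) ^ 2).symm
      _ ≤ ∑ i, dist (replaceHead k x ω i) (replaceHead k y ω i) ^ 2 :=
          Finset.sum_le_sum_of_subset_of_nonneg (Finset.filter_subset _ _)
            fun i _ _ => by positivity
  exact ⟨SchwartzMap.compCLMOfAntilipschitz ℂ hg ha φ, fun y => rfl⟩

theorem lintegral_enorm_partialFourierIntegral {d : ℕ} (k : ℕ) (φ : 𝓢(RSpace d, ℂ)) :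
    ∫⁻ ω, ‖partialFourierIntegral k φ ω‖ₑ ^ (2 : ℝ) = ∫⁻ ω, ‖φ ω‖ₑ ^ (2 : ℝ) := by
  rw [lintegral_eq_lintegral_replaceHead k _
      ((measurable_partialFourierIntegral k φ).enorm.pow_const _),
    lintegral_eq_lintegral_replaceHead k _ (φ.continuous.measurable.enorm.pow_const _)]
  refine lintegral_congr fun x₂ => ?_
  set τ : RSpace d := WithLp.toLp 2 fun i => if h : (i : ℕ) < k then 0 else x₂ ⟨i, h⟩
  obtain ⟨ψ, hψ⟩ := exists_schwartz_slice k φ τ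
  have hF : ∀ y, partialFourierIntegral k φ (replaceHead k y τ) = (FourierTransform.fourier ψ) y := by
    intro y
    have e1 : headPart k (replaceHead k y τ) = y := by
      ext i; simp [headPart, replaceHead, i.2]
    have e2 : ∀ y', replaceHead k y' (replaceHead k y τ) = replaceHead k y' τ := by
      intro y'; ext i; by_cases h : (i : ℕ) < k <;> simp [replaceHead, h]
    rw [SchwartzMap.fourier_coe, Real.fourier_eq', partialFourierIntegral]
    refine integral_congr_ae (.of_forall fun y' => ?_)
    simp only [e1, e2, hψ, smul_eq_mul]
    rw [mul_comm, real_inner_comm]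
    congr 2
    push_cast
    ring
  simp_rw [hF, ← hψ]
  have h := SchwartzMap.norm_fourier_toL2_eq ψ
  rw [SchwartzMap.norm_toLp, SchwartzMap.norm_toLp, ENNReal.toReal_eq_toReal_iff'
    (SchwartzMap.memLp _ 2 volume).2.ne (SchwartzMap.memLp _ 2 volume).2.ne,
    eLpNorm_eq_lintegral_rpow_enorm_toReal (by simp) (by simp),
    eLpNorm_eq_lintegral_rpow_enorm_toReal (by simp) (by simp)] at h
  simpa using (ENNReal.rpow_left_injective (by simp) h)

theorem eLpNorm_partialFourierIntegral {d : ℕ} (k : ℕ) (φ : 𝓢(RSpace d, ℂ)) :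
    eLpNorm (partialFourierIntegral k φ) 2 volume = eLpNorm φ 2 volume := by
  rw [eLpNorm_eq_lintegral_rpow_enorm_toReal (by simp) (by simp),
    eLpNorm_eq_lintegral_rpow_enorm_toReal (by simp) (by simp), ENNReal.toReal_ofNat,
    lintegral_enorm_partialFourierIntegral k φ]

theorem memLp_partialFourierIntegral {d : ℕ} (k : ℕ) (φ : 𝓢(RSpace d, ℂ)) :
    MemLp (partialFourierIntegral k φ) 2 volume :=
  ⟨(measurable_partialFourierIntegral k φ).aestronglyMeasurable, by
    rw [eLpNorm_partialFourierIntegral]; exact (φ.memLp 2 volume).2⟩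

theorem integrable_partialFourierIntegral {d : ℕ} (k : ℕ) (φ : 𝓢(RSpace d, ℂ)) (ω : RSpace d) :
    Integrable fun y : HeadSpace d k => φ (replaceHead k y ω) *
      Complex.exp (-(2 * (Real.pi : ℂ) * Complex.I *
        ((inner ℝ (headPart k ω) y : ℝ) : ℂ))) := by
  obtain ⟨ψ, hψ⟩ := exists_schwartz_slice k φ ω
  simp_rw [← hψ]
  refine ψ.integrable.mul_bdd (c := 1) (by fun_prop) (.of_forall fun y => ?_)
  rw [Complex.norm_exp]
  simp

/-- The partial Fourier transform in the first `k` variables, from the Schwartz space to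
`L²(ℝᵈ)`, given by the partial Fourier integral. -/
def partialFourierSchwartz (d k : ℕ) :
    𝓢(RSpace d, ℂ) →ₗ[ℂ] Lp ℂ 2 (volume : Measure (RSpace d)) where
  toFun φ := (memLp_partialFourierIntegral k φ).toLp (partialFourierIntegral k φ)
  map_add' φ ψ := by
    rw [← MemLp.toLp_add]
    congr 1
    funext ω
    simp only [partialFourierIntegral, Pi.add_apply, add_apply, add_mul]
    exact integral_add (integrable_partialFourierIntegral k φ ω)
      (integrable_partialFourierIntegral k ψ ω)
  map_smul' c φ := by
    rw [RingHom.id_apply, ← MemLp.toLp_const_smul]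
    congr 1
    funext ω
    simp only [partialFourierIntegral, Pi.smul_apply, smul_apply, smul_eq_mul,
      mul_assoc]
    exact integral_const_mul _ _

theorem norm_partialFourierSchwartz (d k : ℕ) (φ : 𝓢(RSpace d, ℂ)) :
    ‖partialFourierSchwartz d k φ‖ = ‖SchwartzMap.toLpCLM ℂ ℂ 2 volume φ‖ := by
  rw [SchwartzMap.toLpCLM_apply, SchwartzMap.norm_toLp, ← eLpNorm_partialFourierIntegral k φ]
  exact Lp.norm_toLp _ (memLp_partialFourierIntegral k φ)

/-- The partial Fourier transform `𝓕ₖ` in the first `k` variables on `L²(ℝᵈ)`: the unique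
continuous extension to `L²(ℝᵈ)` of the partial Fourier integral on Schwartz functions. -/
def partialFourier (d k : ℕ) :
    Lp ℂ 2 (volume : Measure (RSpace d)) →L[ℂ] Lp ℂ 2 (volume : Measure (RSpace d)) :=
  (partialFourierSchwartz d k).extendOfNorm
    (SchwartzMap.toLpCLM ℂ ℂ 2 (volume : Measure (RSpace d))).toLinearMap

/-- On Schwartz functions, `𝓕ₖ` is the partial Fourier integral. -/
theorem partialFourier_toLp (d k : ℕ) (φ : 𝓢(RSpace d, ℂ)) :
    partialFourier d k (φ.toLp 2) =
      (memLp_partialFourierIntegral k φ).toLp (partialFourierIntegral k φ) :=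
  LinearMap.extendOfNorm_eq (f := partialFourierSchwartz d k)
    (e := (SchwartzMap.toLpCLM ℂ ℂ 2 (volume : Measure (RSpace d))).toLinearMap)
    (SchwartzMap.denseRange_toLpCLM (E := RSpace d) (F := ℂ) (p := 2) (μ := volume)
      ENNReal.ofNat_ne_top)
    ⟨1, fun φ => by rw [one_mul]; exact (norm_partialFourierSchwartz d k φ).le⟩ φ

/-- The operator `𝓕ₖ` preserves the norm of `L²(ℝᵈ)`. -/
theorem norm_partialFourier (d k : ℕ) (f : Lp ℂ 2 (volume : Measure (RSpace d))) :
    ‖partialFourier d k f‖ = ‖f‖ := by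
  have hd : DenseRange (SchwartzMap.toLpCLM ℂ (E := RSpace d) ℂ 2 volume) :=
    SchwartzMap.denseRange_toLpCLM ENNReal.ofNat_ne_top
  refine hd.induction_on f (isClosed_eq (by fun_prop) (by fun_prop)) fun φ => ?_
  rw [← norm_partialFourierSchwartz d k φ, SchwartzMap.toLpCLM_apply, partialFourier_toLp]
  rfl

end

/-! Split `ℝᵈ` into the first `k` variables and the passive rest. Integrating `f` and its partial
transform `F` against `1_A(t) w(t)` in the passive variable `t`, where `w(t) =
e^{-π|t|²}/(1+|t|)^k`, gives functions `u` and `v` of `k` variables, still Fourier dual to each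
other. The weight `w` absorbs both the passive part of `e^{2π|x·ω|}` and the passive part of the
norms, so `u` and `v` satisfy Beurling's condition with exponent `k`, the dimension. If this forces
`v = 0` for every measurable `A`, then `F = 0`, and `f = 0` because the partial transform is
isometric.

For Beurling's theorem with this critical exponent, replace `v` by `a = v e^{-π|y|²}` and `u` by its
convolution `G` with the Gaussian; `lintegral_smoothing_lt_top` keeps the hypothesis. Now `G`
extends along each line `ℝω` to an entire function `g` of order at most two with `|g(z)| ≤ M(|Im
z|)`, `M(r) = ∫ |a(y)| e^{2πr|⟨ω,y⟩|} dy`. In polar coordinates the hypothesis says that, for almost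
every `ω` and with `n = k - 1`, the integral of `|g(±r)| M(r) r^n/(1+r)^{n+1}` over `r > 0` is
finite.

The one-variable argument studies `H(ζ) = ∫₀¹ g(tζ) g(itζ) tⁿ dt`. It is bounded on both axes, since
there one factor is evaluated at real points and the other is at most `M`. Order two is critical in
a quadrant, so Phragmén-Lindelöf is applied with the first factor turned by `-α`, in the sector
between the arguments `α` and `π/2`, and then `α → 0` (`AxisBound.norm_radialMean_le`). Thus `H` is
constant by Liouville. Finiteness of the radial integral gives `H(R) → 0`, so `H = 0`, whence `g(s)
g(is) = 0` for `s > 0` and `g = 0`. Fourier uniqueness then gives `a = 0` and `v = 0`. -/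

/-! ### Entire functions given by integrals, and radial means. -/

open Filter Topology Set in
/-- A locally dominated integral of entire functions is entire. -/
theorem differentiable_integral_of_dominated {α : Type*} [MeasurableSpace α] {μ : Measure α}
    {F : ℂ → α → ℂ} (hm : ∀ z, AEStronglyMeasurable (F z) μ)
    (hd : ∀ a, Differentiable ℂ fun z => F z a)
    (hb : ∀ R : ℝ, ∃ bound : α → ℝ, Integrable bound μ ∧
      ∀ᵐ a ∂μ, ∀ z, ‖z‖ ≤ R → ‖F z a‖ ≤ bound a) :
    Differentiable ℂ fun z => ∫ a, F z a ∂μ := by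
  -- The radius `‖z₀‖ + 2` leaves room for a unit ball about `z₀` and a unit circle about each of
  -- its points, on which Cauchy's estimate bounds the derivative by `bound`.
  intro z₀
  obtain ⟨bound, hbi, hbd⟩ := hb (‖z₀‖ + 2)
  have hm' : AEStronglyMeasurable (fun a => deriv (fun z => F z a) z₀) μ := by
    have ht : Tendsto (fun n : ℕ => ((1 / ((n : ℝ) + 1) : ℝ) : ℂ)) atTop (𝓝[≠] 0) := by
      refine tendsto_nhdsWithin_iff.2 ⟨?_, .of_forall fun n => ?_⟩
      · exact_mod_cast (Complex.continuous_ofReal.tendsto 0).comp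
          tendsto_one_div_add_atTop_nhds_zero_nat
      · have : (1 / ((n : ℝ) + 1) : ℝ) ≠ 0 := by positivity
        exact Complex.ofReal_ne_zero.2 this
    refine aestronglyMeasurable_of_tendsto_ae atTop
      (f := fun n : ℕ => fun a => ((1 / ((n : ℝ) + 1) : ℝ) : ℂ)⁻¹ •
        (F (z₀ + ((1 / ((n : ℝ) + 1) : ℝ) : ℂ)) a - F z₀ a)) (fun n => ?_) ?_
    · exact ((hm (z₀ + ((1 / ((n : ℝ) + 1) : ℝ) : ℂ))).sub (hm z₀)).const_smul
        (((1 / ((n : ℝ) + 1) : ℝ) : ℂ)⁻¹)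
    · exact .of_forall fun a => ((hd a z₀).hasDerivAt.tendsto_slope_zero).comp ht
  refine (hasDerivAt_integral_of_dominated_loc_of_deriv_le (F := F)
    (F' := fun z a => deriv (fun z => F z a) z) (bound := bound)
    (Metric.ball_mem_nhds z₀ one_pos) (.of_forall hm) ?_ hm' ?_ hbi ?_).2.differentiableAt
  · exact hbi.mono' (hm z₀) (hbd.mono fun a ha => ha z₀ (by linarith))
  · refine hbd.mono fun a ha z hz => ?_
    refine (Complex.norm_deriv_le_of_forall_mem_sphere_norm_le one_pos
      (hd a).diffContOnCl (C := bound a) fun w hw => ha w ?_).trans_eq (div_one _)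
    have h1 : ‖w - z‖ = 1 := by simpa [dist_eq_norm] using hw
    have h2 : ‖z - z₀‖ < 1 := by simpa [dist_eq_norm] using hz
    have h3 : ‖w‖ ≤ ‖w - z‖ + ‖z - z₀‖ + ‖z₀‖ := by
      calc ‖w‖ = ‖(w - z) + (z - z₀) + z₀‖ := by congr 1; ring
        _ ≤ _ := norm_add₃_le
    linarith
  · exact .of_forall fun a z _ => (hd a z).hasDerivAt

/-- The radial average `∫₀¹ p (t ζ) q (t ζ) tⁿ dt` of a product. -/
noncomputable def radialMean (p q : ℂ → ℂ) (n : ℕ) (ζ : ℂ) : ℂ :=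
  ∫ t in (0 : ℝ)..1, p (t * ζ) * q (t * ζ) * (t : ℂ) ^ n

theorem differentiable_radialMean {p q : ℂ → ℂ} (hp : Differentiable ℂ p) (hq : Differentiable ℂ q)
    (n : ℕ) : Differentiable ℂ (radialMean p q n) := by
  have hpc := hp.continuous
  have hqc := hq.continuous
  unfold radialMean
  simp_rw [intervalIntegral.integral_of_le zero_le_one]
  refine differentiable_integral_of_dominated (fun z => ?_) (fun t => by fun_prop) fun R => ?_
  · exact Continuous.aestronglyMeasurable (by fun_prop)
  · obtain ⟨C, hC⟩ := (isCompact_closedBall (0 : ℂ) R).exists_bound_of_continuousOn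
      (f := fun z => p z * q z) (by fun_prop)
    refine ⟨fun _ => C, integrable_const _, ?_⟩
    refine (ae_restrict_mem measurableSet_Ioc).mono fun t ht z hz => ?_
    have h1 : ‖(t : ℂ)‖ ≤ 1 := by
      rw [Complex.norm_real, Real.norm_eq_abs, abs_of_pos ht.1]; exact ht.2
    have h2 : ‖p (t * z) * q (t * z)‖ ≤ C := hC _ (by
      rw [mem_closedBall_zero_iff, norm_mul]
      exact (mul_le_of_le_one_left (norm_nonneg _) h1).trans hz)
    rw [norm_mul, norm_pow]
    exact (mul_le_of_le_one_right (norm_nonneg _) (pow_le_one₀ (norm_nonneg _) h1)).trans h2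

theorem norm_radialMean_le {p q : ℂ → ℂ} {n : ℕ} {ζ : ℂ} {h : ℝ → ℝ}
    (hi : IntervalIntegrable h volume 0 1)
    (hb : ∀ t ∈ Set.Ioc (0 : ℝ) 1, ‖p (t * ζ)‖ * ‖q (t * ζ)‖ * t ^ n ≤ h t) :
    ‖radialMean p q n ζ‖ ≤ ∫ t in (0 : ℝ)..1, h t := by
  refine intervalIntegral.norm_integral_le_of_norm_le zero_le_one (.of_forall fun t ht => ?_) hi
  refine le_trans (le_of_eq ?_) (hb t ht)
  rw [norm_mul, norm_mul, norm_pow, Complex.norm_real, Real.norm_eq_abs, abs_of_pos ht.1]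

theorem Monotone.intervalIntegrable_mul_comp_mul {M : ℝ → ℝ} (hM : Monotone M) {f : ℝ → ℝ}
    (hf : Continuous f) (R : ℝ) (hR : 0 ≤ R) (a b : ℝ) (n : ℕ) :
    IntervalIntegrable (fun t => f t * M (t * R) * t ^ n) volume a b := by
  have h : Monotone fun t => M (t * R) := fun s t hst =>
    hM (mul_le_mul_of_nonneg_right hst hR)
  exact (h.intervalIntegrable.continuousOn_mul hf.continuousOn).mul_continuousOn
    (by fun_prop)

/-! ### Phragmén-Lindelöf and Liouville for radial means. -/

/-- Comparison data for the product of two entire functions `p`, `q` of order two, `p` being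
controlled on the real axis and `q` on the imaginary axis. -/
structure AxisBound (p q : ℂ → ℂ) (M : ℝ → ℝ) (n : ℕ) (B : ℝ) : Prop where
  diff_left : Differentiable ℂ p
  diff_right : Differentiable ℂ q
  mono : Monotone M
  norm_left_le : ∀ z, ‖p z‖ ≤ M |z.im|
  norm_right_le : ∀ z, ‖q z‖ ≤ M |z.re|
  integral_left_le : ∀ R : ℝ, ∫ t in (0 : ℝ)..1, ‖p (t * R)‖ * M (t * |R|) * t ^ n ≤ B
  integral_right_le : ∀ R : ℝ,
    ∫ t in (0 : ℝ)..1, ‖q (t * R * Complex.I)‖ * M (t * |R|) * t ^ n ≤ B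

namespace AxisBound

variable {p q : ℂ → ℂ} {M : ℝ → ℝ} {n : ℕ} {B : ℝ}

theorem nonneg (h : AxisBound p q M n B) (r : ℝ) (hr : 0 ≤ r) : 0 ≤ M r := by
  have := (norm_nonneg _).trans (h.norm_left_le (r * Complex.I))
  simpa [abs_of_nonneg hr] using this

/-- A quarter turn exchanges the axes and the roles of `p` and `q`, so a bound in one quadrant
yields the other three. -/
theorem rotate (h : AxisBound p q M n B) :
    AxisBound (fun z => q (Complex.I * z)) (fun z => p (Complex.I * z)) M n B where
  diff_left := h.diff_right.comp (by fun_prop)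
  diff_right := h.diff_left.comp (by fun_prop)
  mono := h.mono
  norm_left_le z := by simpa using h.norm_right_le (Complex.I * z)
  norm_right_le z := by simpa using h.norm_left_le (Complex.I * z)
  integral_left_le R := by
    have := h.integral_right_le R
    simpa [mul_comm, mul_left_comm] using this
  integral_right_le R := by
    have := h.integral_left_le (-R)
    have e : ∀ t : ℝ, Complex.I * (t * R * Complex.I) = t * ((-R : ℝ) : ℂ) := fun t => by
      push_cast
      linear_combination (t * R : ℂ) * Complex.I_mul_I
    simp only [e]
    simpa using this

/-- On the ray of argument `α` the rotated `p` is evaluated at real points, while the real part of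
the argument of `q` is at most its modulus; monotonicity of `M` then reduces to `integral_left_le`.
-/
theorem norm_radialMean_le_of_real (h : AxisBound p q M n B) {α : ℝ} {R : ℝ} (hR : 0 < R) :
    ‖radialMean (fun z => p (Complex.exp (-(α * Complex.I)) * z)) q n
      (R * Complex.exp (α * Complex.I))‖ ≤ B := by
  refine (norm_radialMean_le (h.mono.intervalIntegrable_mul_comp_mul
    (f := fun t : ℝ => ‖p (t * R)‖) ?_ |R| (abs_nonneg R) 0 1 n) fun t ht => ?_).trans
    (h.integral_left_le R)
  · have := h.diff_left.continuous; fun_prop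
  · have e : Complex.exp (-(α * Complex.I)) * (t * (R * Complex.exp (α * Complex.I))) = t * R := by
      rw [Complex.exp_neg]
      field_simp
    simp only [e]
    have ht0 := ht.1.le
    gcongr
    refine (h.norm_right_le _).trans (h.mono ?_)
    rw [abs_of_pos hR, ← mul_assoc, ← Complex.ofReal_mul, Complex.re_ofReal_mul,
      Complex.exp_ofReal_mul_I_re, abs_mul, abs_of_nonneg (by positivity)]
    exact mul_le_of_le_one_right (by positivity) (Real.abs_cos_le_one _)

/-- The other edge of the sector: `q` sits on its controlled axis, and turning the argument of `p`
does not increase its modulus. -/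
theorem norm_radialMean_le_of_imag (h : AxisBound p q M n B) {α : ℝ} {R : ℝ} (hR : 0 < R) :
    ‖radialMean (fun z => p (Complex.exp (-(α * Complex.I)) * z)) q n (R * Complex.I)‖ ≤ B := by
  refine (norm_radialMean_le (h.mono.intervalIntegrable_mul_comp_mul
    (f := fun t : ℝ => ‖q (t * R * Complex.I)‖) ?_ |R| (abs_nonneg R) 0 1 n) fun t ht => ?_).trans
    (h.integral_right_le R)
  · have := h.diff_right.continuous; fun_prop
  · rw [mul_comm ‖p _‖, ← mul_assoc (t : ℂ)]
    have ht0 := ht.1.le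
    gcongr
    refine (h.norm_left_le _).trans (h.mono ?_)
    have e : Complex.exp (-(α * Complex.I)) * (t * R * Complex.I) =
        ((t * R : ℝ) : ℂ) * (Complex.exp ((-α : ℝ) * Complex.I) * Complex.I) := by
      push_cast
      rw [neg_mul]; ring
    rw [e, Complex.im_ofReal_mul, abs_mul, Complex.mul_I_im, Complex.exp_ofReal_mul_I_re,
      abs_of_pos hR, abs_of_nonneg (by positivity)]
    exact mul_le_of_le_one_right (by positivity) (Real.abs_cos_le_one _)

end AxisBound

namespace AxisBound

variable {p q : ℂ → ℂ} {M : ℝ → ℝ} {n : ℕ} {B : ℝ}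

-- The sector has opening `π/2 - α`, so order two is below the critical order. The bound `B` does
-- not depend on `α`.
open Complex Filter Topology in
theorem norm_radialMean_rotated_le (h : AxisBound p q M n B) {C c : ℝ}
    (hM : ∀ r, 0 ≤ r → M r ≤ C * Real.exp (c * r ^ 2)) {α : ℝ} (hα : 0 < α)
    (hα' : α < Real.pi / 2) {w : ℂ} (hw : α ≤ w.im) (hw' : w.im ≤ Real.pi / 2) :
    ‖radialMean (fun z => p (exp (-(α * I)) * z)) q n (exp w)‖ ≤ B := by
  have hd : Differentiable ℂ (radialMean (fun z => p (exp (-(α * I)) * z)) q n) :=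
    differentiable_radialMean (h.diff_left.comp (by fun_prop)) h.diff_right n
  have hexp : ∀ w : ℂ, exp w = ((Real.exp w.re : ℝ) : ℂ) * exp (w.im * I) := fun w => by
    rw [ofReal_exp, ← exp_add, re_add_im]
  -- In the logarithmic coordinate `w` the sector is a strip and order two becomes growth `exp(2c
  -- e^{2|Re w|})`; the rate `2` is admissible because `2 < π/(π/2 - α)`.
  refine PhragmenLindelof.horizontal_strip (a := α) (b := Real.pi / 2)
    (f := fun w => radialMean (fun z => p (exp (-(α * I)) * z)) q n (exp w))
    (hd.comp differentiable_exp).diffContOnCl ⟨2, ?_, 2 * c, ?_⟩ ?_ ?_ hw hw'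
  · rw [lt_div_iff₀ (by linarith)]
    linarith
  · refine Asymptotics.IsBigO.of_bound (C ^ 2) (.of_forall fun w => ?_)
    have hr := Real.exp_pos |w.re|
    set r := Real.exp |w.re|
    have hMr : M r * M r ≤ C ^ 2 * ‖Real.exp (2 * c * Real.exp (2 * |w.re|))‖ := by
      have e : Real.exp (2 * c * Real.exp (2 * |w.re|)) = Real.exp (c * r ^ 2) ^ 2 := by
        rw [← Real.exp_nat_mul, ← Real.exp_nat_mul]
        congr 1; push_cast; ring
      rw [Real.norm_eq_abs, Real.abs_exp, e, ← mul_pow, sq]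
      exact mul_self_le_mul_self (h.nonneg r hr.le) (hM r hr.le)
    refine le_trans ?_ hMr
    have hle : ‖exp w‖ ≤ r := by
      rw [norm_exp]; exact Real.exp_le_exp.2 (le_abs_self _)
    refine (norm_radialMean_le (h := fun _ => M r * M r) (by simp) fun t ht => ?_).trans
      (by simp)
    have ht0 := ht.1.le
    have hn : ‖(t : ℂ) * exp w‖ ≤ r := by
      rw [norm_mul, norm_real, Real.norm_eq_abs, abs_of_pos ht.1]
      exact (mul_le_of_le_one_left (norm_nonneg _) ht.2).trans hle
    have hp : ‖p (exp (-(α * I)) * (t * exp w))‖ ≤ M r := by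
      refine (h.norm_left_le _).trans (h.mono ((abs_im_le_norm _).trans ?_))
      rw [norm_mul, ← neg_mul, ← ofReal_neg, norm_exp_ofReal_mul_I, one_mul]
      exact hn
    have hq : ‖q (t * exp w)‖ ≤ M r :=
      (h.norm_right_le _).trans (h.mono ((abs_re_le_norm _).trans hn))
    have hM0 := h.nonneg r hr.le
    calc _ ≤ M r * M r * 1 := by
          gcongr
          exact pow_le_one₀ ht0 ht.2
      _ = _ := mul_one _
  · intro z hz
    simp only [hexp z, hz]
    exact h.norm_radialMean_le_of_real (Real.exp_pos _)
  · intro z hz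
    simp only [hexp z, hz]
    have : exp (((Real.pi / 2 : ℝ) : ℂ) * I) = I := by
      push_cast; exact exp_pi_div_two_mul_I
    rw [this]
    exact h.norm_radialMean_le_of_imag (Real.exp_pos _)

-- For fixed `ζ` the rotated means converge as `α → 0⁺`, and `ζ` lies in the sector once `α < arg
-- ζ`.
open Complex Filter Topology in
theorem norm_radialMean_le_of_mem_quadrant (h : AxisBound p q M n B) {C c : ℝ}
    (hM : ∀ r, 0 ≤ r → M r ≤ C * Real.exp (c * r ^ 2)) {ζ : ℂ} (hre : 0 < ζ.re)
    (him : 0 < ζ.im) : ‖radialMean p q n ζ‖ ≤ B := by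
  have hζ : ζ ≠ 0 := fun h => by simp [h] at hre
  have hpc := h.diff_left.continuous
  have hqc := h.diff_right.continuous
  have harg : 0 < (log ζ).im := by
    rw [log_im]
    exact (arg_nonneg_iff.2 him.le).lt_of_ne fun h0 => him.ne' (arg_eq_zero_iff.1 h0.symm).2
  have harg' : (log ζ).im < Real.pi / 2 := by
    rw [log_im]; exact (abs_lt.1 (abs_arg_lt_pi_div_two_iff.2 (.inl hre))).2
  have hcont : Continuous fun α : ℝ => radialMean (fun z => p (exp (-(α * I)) * z)) q n ζ := by
    unfold radialMean
    exact intervalIntegral.continuous_parametric_intervalIntegral_of_continuous' (by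
      unfold Function.uncurry; fun_prop) _ _
  have hlim : Tendsto (fun α : ℝ => ‖radialMean (fun z => p (exp (-(α * I)) * z)) q n ζ‖)
      (𝓝[>] 0) (𝓝 ‖radialMean p q n ζ‖) := by
    have := (hcont.norm.tendsto 0).mono_left (nhdsWithin_le_nhds (s := Set.Ioi 0))
    simpa using this
  refine le_of_tendsto hlim ?_
  filter_upwards [Ioo_mem_nhdsGT harg] with α hα
  have := h.norm_radialMean_rotated_le hM hα.1 (hα.2.trans harg') hα.2.le harg'.le
  rwa [exp_log hζ] at this

open Complex in
theorem radialMean_rotate (p q : ℂ → ℂ) (n : ℕ) (ζ : ℂ) :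
    radialMean (fun z => q (I * z)) (fun z => p (I * z)) n ζ = radialMean p q n (I * ζ) := by
  unfold radialMean
  congr 1
  ext t
  simp only [mul_left_comm I]
  ring

open Complex Filter Topology in
theorem norm_radialMean_le (h : AxisBound p q M n B) {C c : ℝ}
    (hM : ∀ r, 0 ≤ r → M r ≤ C * Real.exp (c * r ^ 2)) (ζ : ℂ) : ‖radialMean p q n ζ‖ ≤ B := by
  have hc := (differentiable_radialMean h.diff_left h.diff_right n).continuous
  have key : ∀ ζ : ℂ, ζ.re ≠ 0 → ζ.im ≠ 0 → ‖radialMean p q n ζ‖ ≤ B := by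
    intro ζ h1 h2
    have e1 : ∀ ζ, radialMean p q n ζ =
        radialMean (fun z => q (I * z)) (fun z => p (I * z)) n (-I * ζ) := fun ζ => by
      rw [radialMean_rotate]
      congr 1; linear_combination ζ * I_mul_I
    have e2 : ∀ ζ, radialMean p q n ζ =
        radialMean (fun z => p (I * (I * z))) (fun z => q (I * (I * z))) n (-ζ) := fun ζ => by
      rw [radialMean_rotate (fun z => q (I * z)) (fun z => p (I * z)), radialMean_rotate]
      congr 1; linear_combination ζ * I_mul_I
    have e3 : ∀ ζ, radialMean p q n ζ =
        radialMean (fun z => q (I * (I * (I * z)))) (fun z => p (I * (I * (I * z)))) n (I * ζ) :=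
      fun ζ => by
      rw [radialMean_rotate (fun z => p (I * (I * z))) (fun z => q (I * (I * z))),
        radialMean_rotate (fun z => q (I * z)) (fun z => p (I * z)), radialMean_rotate]
      congr 1; linear_combination ζ * (1 - I * I) * I_mul_I
    rcases lt_or_gt_of_ne h1 with h1 | h1 <;> rcases lt_or_gt_of_ne h2 with h2 | h2
    · rw [e2]
      exact h.rotate.rotate.norm_radialMean_le_of_mem_quadrant hM (by simpa) (by simpa)
    · rw [e1]
      exact h.rotate.norm_radialMean_le_of_mem_quadrant hM (by simpa) (by simpa)
    · rw [e3]
      exact h.rotate.rotate.rotate.norm_radialMean_le_of_mem_quadrant hM (by simpa) (by simpa)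
    · exact h.norm_radialMean_le_of_mem_quadrant hM h1 h2
  -- Points on the axes are limits along the diagonal direction of points off both axes.
  have hseq : Tendsto (fun ε : ℝ => ‖radialMean p q n (ζ + ε * (1 + I))‖) (𝓝[>] 0)
      (𝓝 ‖radialMean p q n ζ‖) := by
    have h0 : Continuous fun ε : ℝ => ‖radialMean p q n (ζ + ε * (1 + I))‖ := by fun_prop
    have := (h0.tendsto 0).mono_left (nhdsWithin_le_nhds (s := Set.Ioi 0))
    simpa using this
  have hne : ∀ a : ℝ, ∀ᶠ ε : ℝ in 𝓝[>] 0, a + ε ≠ 0 := fun a => by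
    rcases lt_or_ge a 0 with ha | ha
    · filter_upwards [Ioo_mem_nhdsGT (neg_pos.2 ha)] with ε hε
      have := hε.2; linarith
    · filter_upwards [self_mem_nhdsWithin] with ε hε
      have : 0 < ε := hε
      linarith
  refine le_of_tendsto hseq ?_
  filter_upwards [hne ζ.re, hne ζ.im] with ε h1 h2
  exact key _ (by simpa using h1) (by simpa using h2)

open Complex Filter Topology in
/-- If the radial means of the bounds decay along the positive real axis, the product vanishes. -/
theorem mul_eq_zero (h : AxisBound p q M n B) {C c : ℝ}
    (hM : ∀ r, 0 ≤ r → M r ≤ C * Real.exp (c * r ^ 2))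
    (hlim : Tendsto (fun R : ℝ => ∫ t in (0 : ℝ)..1, ‖p (t * R)‖ * M (t * R) * t ^ n) atTop (𝓝 0))
    {R : ℝ} (hR : 0 < R) : p R * q R = 0 := by
  have hpc := h.diff_left.continuous
  have hqc := h.diff_right.continuous
  have hbdd : Bornology.IsBounded (Set.range (radialMean p q n)) :=
    isBounded_iff_forall_norm_le.2 ⟨B, by rintro _ ⟨ζ, rfl⟩; exact h.norm_radialMean_le hM ζ⟩
  have hconst := (differentiable_radialMean h.diff_left h.diff_right n).apply_eq_apply_of_bounded
    hbdd
  have hzero : ∀ ζ, radialMean p q n ζ = 0 := by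
    intro ζ
    rw [← norm_le_zero_iff]
    refine ge_of_tendsto hlim ?_
    filter_upwards [eventually_gt_atTop 0] with R hR
    rw [hconst ζ R]
    refine _root_.norm_radialMean_le (h.mono.intervalIntegrable_mul_comp_mul
      (f := fun t : ℝ => ‖p (t * R)‖) (by fun_prop) R hR.le 0 1 n) fun t ht => ?_
    have ht0 := ht.1.le
    gcongr
    refine (h.norm_right_le _).trans (h.mono ?_)
    rw [← ofReal_mul, ofReal_re, abs_of_nonneg (by positivity)]
  have hint : ∀ r : ℝ, ∫ s in (0 : ℝ)..r, p s * q s * (s : ℂ) ^ n = 0 := by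
    intro r
    have h1 := hzero r
    unfold radialMean at h1
    have h2 := intervalIntegral.smul_integral_comp_mul_right (a := 0) (b := 1)
      (fun s : ℝ => p s * q s * (s : ℂ) ^ n) r
    rw [zero_mul, one_mul] at h2
    rw [← h2]
    have h3 : (fun t : ℝ => p ((t * r : ℝ) : ℂ) * q ((t * r : ℝ) : ℂ) * ((t * r : ℝ) : ℂ) ^ n) =
        fun t : ℝ => (p (t * r) * q (t * r) * (t : ℂ) ^ n) * (r : ℂ) ^ n := by
      ext t; push_cast; ring
    rw [h3, intervalIntegral.integral_mul_const, h1, zero_mul, smul_zero]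
  -- After rescaling, the vanishing means say that the primitive of `p q sⁿ` is identically zero;
  -- its derivative at `R` is the integrand.
  have hder := (Continuous.deriv_integral (fun s : ℝ => p s * q s * (s : ℂ) ^ n)
    (by fun_prop) 0 R)
  simp only [hint, deriv_const'] at hder
  have hR' : (R : ℂ) ^ n ≠ 0 := pow_ne_zero _ (ofReal_ne_zero.2 hR.ne')
  exact (_root_.mul_eq_zero.1 hder.symm).resolve_right hR'

end AxisBound

open Complex Filter Topology in
/-- An entire function whose product with its rotation by a right angle vanishes on the positive
real axis is zero. -/
theorem eq_zero_of_mul_rotate_eq_zero {g : ℂ → ℂ} (hg : Differentiable ℂ g)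
    (h : ∀ R : ℝ, 0 < R → g R * g (I * R) = 0) (z : ℂ) : g z = 0 := by
  have hprod : Differentiable ℂ fun z => g z * g (I * z) := hg.mul (hg.comp (by fun_prop))
  have hfreq : ∃ᶠ z : ℂ in 𝓝[≠] 0, g z * g (I * z) = 0 := by
    have ht : Tendsto (fun r : ℝ => (r : ℂ)) (𝓝[>] 0) (𝓝[≠] 0) := by
      refine tendsto_nhdsWithin_iff.2 ⟨?_, ?_⟩
      · exact_mod_cast (continuous_ofReal.tendsto 0).mono_left nhdsWithin_le_nhds
      · filter_upwards [self_mem_nhdsWithin] with r hr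
        exact ofReal_ne_zero.2 (ne_of_gt hr)
    refine ht.frequently (Eventually.frequently ?_)
    filter_upwards [self_mem_nhdsWithin] with r hr
    exact h r hr
  have hev : ∀ᶠ z : ℂ in 𝓝 0, g z * g (I * z) = 0 :=
    ((hprod.analyticAt 0).frequently_zero_iff_eventually_zero).1 hfreq
  -- At least one of the two factors has zeros accumulating at `0`, so the identity theorem applies
  -- to it.
  have hfreq' : ∃ᶠ z : ℂ in 𝓝[≠] 0, g z = 0 ∨ g (I * z) = 0 :=
    (hev.filter_mono nhdsWithin_le_nhds |>.mono fun z hz => mul_eq_zero.1 hz).frequently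
  have key : ∀ {u : ℂ → ℂ}, Differentiable ℂ u → (∃ᶠ z : ℂ in 𝓝[≠] 0, u z = 0) →
      ∀ z, u z = 0 := fun hu hf z => by
    have h1 : AnalyticOnNhd ℂ _ Set.univ := fun z _ => hu.analyticAt z
    exact congrFun (h1.eq_of_frequently_eq (g := fun _ => 0) (fun z _ => analyticAt_const) hf) z
  rcases frequently_or_distrib.1 hfreq' with h1 | h1
  · exact key hg h1 z
  · have := key (hg.comp (by fun_prop : Differentiable ℂ fun z => I * z)) h1 (-I * z)
    simpa [← mul_assoc] using this

/-! ### Radial averages controlled by the critical weight. -/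

-- Substituting `r = tR` gives `φ(r) rⁿ/R^{n+1}` on `(0, R]`. Writing this as the weighted integrand
-- times `((1+r)/R)^{n+1}` isolates a factor that is at most `2^{n+1}` for `R ≥ 1` and tends to `0`
-- for fixed `r`: hence both boundedness and decay, by dominated convergence.
open Set in
theorem intervalIntegral_comp_mul_mul_pow_eq (φ : ℝ → ℝ) (n : ℕ) {R : ℝ} (hR : 0 < R) :
    ∫ t in (0 : ℝ)..1, φ (t * R) * t ^ n = ∫ r in Ioi (0 : ℝ),
      (Iic R).indicator (fun r => φ r * r ^ n / (1 + r) ^ (n + 1) * ((1 + r) / R) ^ (n + 1)) r := by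
  rw [setIntegral_indicator measurableSet_Iic, Ioi_inter_Iic, ← intervalIntegral.integral_of_le hR.le]
  have h := intervalIntegral.smul_integral_comp_mul_right (a := 0) (b := 1)
    (fun r : ℝ => φ r * (r / R) ^ n / R) R
  rw [zero_mul, one_mul, ← intervalIntegral.integral_smul] at h
  have e1 : (fun t : ℝ => R • (φ (t * R) * (t * R / R) ^ n / R)) = fun t => φ (t * R) * t ^ n := by
    ext t
    rw [smul_eq_mul, mul_div_cancel_right₀ _ hR.ne']
    field_simp
  rw [e1] at h
  rw [h]
  refine intervalIntegral.integral_congr fun r hr => ?_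
  rw [uIcc_of_le hR.le] at hr
  have : (1 + r) ≠ 0 := by linarith [hr.1]
  simp only [div_pow]
  rw [div_mul_div_cancel₀ (pow_ne_zero _ this), pow_succ]
  field_simp

open Set in
theorem indicator_Iic_mul_pow_le {h : ℝ → ℝ} {n : ℕ} {R r : ℝ} (hR : 1 ≤ R) (hr : 0 < r)
    (hh : 0 ≤ h r) : (Iic R).indicator (fun r => h r * ((1 + r) / R) ^ n) r ≤ 2 ^ n * h r := by
  by_cases hrR : r ∈ Iic R
  · rw [indicator_of_mem hrR, mul_comm]
    gcongr
    rw [div_le_iff₀ (by linarith)]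
    linarith [mem_Iic.1 hrR]
  · rw [indicator_of_notMem hrR]; positivity

open Set in
theorem indicator_Iic_mul_pow_nonneg {h : ℝ → ℝ} {n : ℕ} {R r : ℝ} (hR : 0 ≤ R) (hr : 0 < r)
    (hh : 0 ≤ h r) : 0 ≤ (Iic R).indicator (fun r => h r * ((1 + r) / R) ^ n) r := by
  by_cases hrR : r ∈ Iic R
  · rw [indicator_of_mem hrR]; positivity
  · rw [indicator_of_notMem hrR]

section

variable {φ : ℝ → ℝ} {n : ℕ}

open Set in
theorem intervalIntegral_comp_mul_mul_pow_le (hφ : ∀ r, 0 < r → 0 ≤ φ r)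
    (hi : IntegrableOn (fun r => φ r * r ^ n / (1 + r) ^ (n + 1)) (Ioi 0)) {R : ℝ} (hR : 1 ≤ R) :
    ∫ t in (0 : ℝ)..1, φ (t * R) * t ^ n ≤
      ∫ r in Ioi (0 : ℝ), 2 ^ (n + 1) * (φ r * r ^ n / (1 + r) ^ (n + 1)) := by
  rw [intervalIntegral_comp_mul_mul_pow_eq φ n (zero_lt_one.trans_le hR)]
  have hn : ∀ r ∈ Ioi (0 : ℝ), 0 ≤ φ r * r ^ n / (1 + r) ^ (n + 1) := fun r hr => by
    have := hφ r hr
    have : 0 < r := hr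
    positivity
  refine integral_mono_of_nonneg ?_ (hi.const_mul _) ?_
  · exact (ae_restrict_mem measurableSet_Ioi).mono fun r hr =>
      indicator_Iic_mul_pow_nonneg (h := fun r => φ r * r ^ n / (1 + r) ^ (n + 1))
        (zero_le_one.trans hR) hr (hn r hr)
  · exact (ae_restrict_mem measurableSet_Ioi).mono fun r hr =>
      indicator_Iic_mul_pow_le (h := fun r => φ r * r ^ n / (1 + r) ^ (n + 1)) hR hr (hn r hr)

open Set Filter Topology in
theorem tendsto_intervalIntegral_comp_mul_mul_pow (hφ : ∀ r, 0 < r → 0 ≤ φ r)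
    (hi : IntegrableOn (fun r => φ r * r ^ n / (1 + r) ^ (n + 1)) (Ioi 0)) :
    Tendsto (fun R : ℝ => ∫ t in (0 : ℝ)..1, φ (t * R) * t ^ n) atTop (𝓝 0) := by
  have hn : ∀ r ∈ Ioi (0 : ℝ), 0 ≤ φ r * r ^ n / (1 + r) ^ (n + 1) := fun r hr => by
    have := hφ r hr
    have : 0 < r := hr
    positivity
  have key : Tendsto (fun R : ℝ => ∫ r in Ioi (0 : ℝ),
      (Iic R).indicator (fun r => φ r * r ^ n / (1 + r) ^ (n + 1) * ((1 + r) / R) ^ (n + 1)) r)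
      atTop (𝓝 (∫ r in Ioi (0 : ℝ), (0 : ℝ))) := by
    refine tendsto_integral_filter_of_dominated_convergence
      (fun r => 2 ^ (n + 1) * (φ r * r ^ n / (1 + r) ^ (n + 1))) (.of_forall fun R => ?_) ?_
      (hi.const_mul _) ?_
    · exact (hi.aestronglyMeasurable.mul
        (Continuous.aestronglyMeasurable (by fun_prop))).indicator measurableSet_Iic
    · filter_upwards [eventually_ge_atTop 1] with R hR
      refine (ae_restrict_mem measurableSet_Ioi).mono fun r hr => ?_
      rw [Real.norm_eq_abs, abs_of_nonneg (indicator_Iic_mul_pow_nonneg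
        (h := fun r => φ r * r ^ n / (1 + r) ^ (n + 1)) (zero_le_one.trans hR) hr (hn r hr))]
      exact indicator_Iic_mul_pow_le (h := fun r => φ r * r ^ n / (1 + r) ^ (n + 1)) hR hr (hn r hr)
    · refine .of_forall fun r => ?_
      have h1 : Tendsto (fun R : ℝ => φ r * r ^ n / (1 + r) ^ (n + 1) * ((1 + r) / R) ^ (n + 1))
          atTop (𝓝 0) := by
        have := ((tendsto_id (α := ℝ) (x := atTop)).const_div_atTop (1 + r)).pow (n + 1)
        simpa using this.const_mul (φ r * r ^ n / (1 + r) ^ (n + 1))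
      refine h1.congr' ?_
      filter_upwards [eventually_ge_atTop r] with R hR
      rw [indicator_of_mem (mem_Iic.2 hR)]
  rw [integral_zero] at key
  refine key.congr' ?_
  filter_upwards [eventually_gt_atTop 0] with R hR
  exact (intervalIntegral_comp_mul_mul_pow_eq φ n hR).symm

end

/-! ### The transform along a line and its majorant. -/

section Directional

variable {E : Type*} [NormedAddCommGroup E] [InnerProductSpace ℝ E]

variable {a : E → ℂ} {ω : E}

/-- This is the arithmetic-geometric inequality. The coefficient `π/2` is half of that of the
smoothing Gaussian `e^{-π‖y‖²}`, so integrability survives; the other term gives growth of order two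
in `r`. -/
theorem two_pi_mul_abs_inner_le (hω : ‖ω‖ = 1) (r : ℝ) (y : E) :
    2 * Real.pi * r * |inner ℝ ω y| ≤ Real.pi / 2 * ‖y‖ ^ 2 + 2 * Real.pi * r ^ 2 := by
  have h1 : |inner ℝ ω y| ≤ ‖y‖ := by simpa [hω] using abs_real_inner_le_norm ω y
  have h2 : r * |inner ℝ ω y| ≤ |r| * ‖y‖ :=
    mul_le_mul (le_abs_self r) h1 (abs_nonneg _) (abs_nonneg _)
  have h3 : 0 ≤ (‖y‖ - 2 * |r|) ^ 2 := sq_nonneg _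
  have h4 : |r| ^ 2 = r ^ 2 := sq_abs r
  have : r * |inner ℝ ω y| ≤ ‖y‖ ^ 2 / 4 + r ^ 2 := by nlinarith
  nlinarith [Real.pi_pos, mul_le_mul_of_nonneg_left this Real.pi_pos.le]

theorem exp_two_pi_mul_abs_inner_le (hω : ‖ω‖ = 1) (r : ℝ) (y : E) :
    Real.exp (2 * Real.pi * r * |inner ℝ ω y|) ≤
      Real.exp (Real.pi / 2 * ‖y‖ ^ 2) * Real.exp (2 * Real.pi * r ^ 2) := by
  rw [← Real.exp_add]
  exact Real.exp_le_exp.2 (two_pi_mul_abs_inner_le hω r y)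

theorem norm_mul_cexp_inner_le (z : ℂ) (y : E) :
    ‖a y * Complex.exp (2 * Real.pi * Complex.I * z * (inner ℝ ω y : ℝ))‖ ≤
      ‖a y‖ * Real.exp (2 * Real.pi * |z.im| * |inner ℝ ω y|) := by
  rw [norm_mul, Complex.norm_exp]
  gcongr
  have e : (2 * Real.pi * Complex.I * z * (inner ℝ ω y : ℝ) : ℂ).re =
      2 * Real.pi * (-(z.im * inner ℝ ω y)) := by
    simp; ring
  rw [e, mul_assoc (2 * Real.pi), ← abs_mul]
  gcongr
  exact neg_le_abs _

/-- The tail of the majorant beyond `‖y‖ = 8 r` is negligible. -/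
theorem exp_inner_div_le (hω : ‖ω‖ = 1) (k : ℕ) {r : ℝ} (hr : 0 < r) (y : E) :
    Real.exp (2 * Real.pi * r * |inner ℝ ω y|) / (1 + r) ^ k ≤
      9 ^ k * (Real.exp (2 * Real.pi * r * |inner ℝ ω y|) / (1 + r + ‖y‖) ^ k) +
        Real.exp (Real.pi / 2 * ‖y‖ ^ 2) * Real.exp (-(r ^ 2)) := by
  rcases le_total ‖y‖ (8 * r) with hy | hy
  · refine le_add_of_le_of_nonneg ?_ (by positivity)
    rw [mul_div_assoc', div_le_div_iff₀ (by positivity) (by positivity)]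
    have : (1 + r + ‖y‖) ^ k ≤ 9 ^ k * (1 + r) ^ k := by
      rw [← mul_pow]
      gcongr
      linarith
    calc _ ≤ Real.exp (2 * Real.pi * r * |inner ℝ ω y|) * (9 ^ k * (1 + r) ^ k) := by gcongr
      _ = _ := by ring
  -- Here `2πr‖y‖ ≤ (π/4)‖y‖²`, and the remaining `(π/4)‖y‖²` is at least `16πr²`, more than `r²`.
  · refine le_add_of_nonneg_of_le (by positivity) ?_
    refine (div_le_self (by positivity) (one_le_pow₀ (by linarith))).trans ?_
    rw [← Real.exp_add]
    refine Real.exp_le_exp.2 ?_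
    have h1 : |inner ℝ ω y| ≤ ‖y‖ := by simpa [hω] using abs_real_inner_le_norm ω y
    have h2 : r * |inner ℝ ω y| ≤ r * ‖y‖ := by gcongr
    have h3 : r * ‖y‖ ≤ ‖y‖ * ‖y‖ / 8 := by nlinarith [norm_nonneg y]
    have h4 : r * r ≤ ‖y‖ * ‖y‖ / 64 := by nlinarith [norm_nonneg y]
    have h5 := Real.pi_gt_three
    have h6 : Real.pi * (r * |inner ℝ ω y|) ≤ Real.pi * (‖y‖ * ‖y‖ / 8) := by gcongr; linarith
    nlinarith [mul_self_nonneg ‖y‖]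

variable [MeasurableSpace E] {μ : Measure E}

/-- The function `z ↦ ∫ a(y) e^{2π i z ⟨ω, y⟩} dy` of one complex variable. -/
noncomputable def directionalTransform (μ : Measure E) (a : E → ℂ) (ω : E) (z : ℂ) : ℂ :=
  ∫ y, a y * Complex.exp (2 * Real.pi * Complex.I * z * (inner ℝ ω y : ℝ)) ∂μ

/-- The majorant `r ↦ ∫ |a(y)| e^{2π r |⟨ω, y⟩|} dy` of the directional transform. -/
noncomputable def directionalMajorant (μ : Measure E) (a : E → ℂ) (ω : E) (r : ℝ) : ℝ :=
  ∫ y, ‖a y‖ * Real.exp (2 * Real.pi * r * |inner ℝ ω y|) ∂μ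

theorem directionalMajorant_nonneg (r : ℝ) : 0 ≤ directionalMajorant μ a ω r :=
  integral_nonneg fun y => by positivity

variable [BorelSpace E]

theorem integrable_norm_mul_exp_abs_inner (hm : AEStronglyMeasurable a μ)
    (ha : Integrable (fun y => ‖a y‖ * Real.exp (Real.pi / 2 * ‖y‖ ^ 2)) μ) (hω : ‖ω‖ = 1) (r : ℝ) :
    Integrable (fun y => ‖a y‖ * Real.exp (2 * Real.pi * r * |inner ℝ ω y|)) μ := by
  refine (ha.mul_const (Real.exp (2 * Real.pi * r ^ 2))).mono'
    (hm.norm.mul (Continuous.aestronglyMeasurable (by fun_prop))) (.of_forall fun y => ?_)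
  rw [Real.norm_eq_abs, abs_of_nonneg (by positivity), mul_assoc ‖a y‖]
  gcongr
  exact exp_two_pi_mul_abs_inner_le hω r y

theorem directionalMajorant_monotone (hm : AEStronglyMeasurable a μ)
    (ha : Integrable (fun y => ‖a y‖ * Real.exp (Real.pi / 2 * ‖y‖ ^ 2)) μ) (hω : ‖ω‖ = 1) :
    Monotone (directionalMajorant μ a ω) := fun r s hrs => by
  refine integral_mono (integrable_norm_mul_exp_abs_inner hm ha hω r)
    (integrable_norm_mul_exp_abs_inner hm ha hω s) fun y => ?_
  dsimp only
  gcongr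

theorem directionalMajorant_le (hm : AEStronglyMeasurable a μ)
    (ha : Integrable (fun y => ‖a y‖ * Real.exp (Real.pi / 2 * ‖y‖ ^ 2)) μ) (hω : ‖ω‖ = 1) (r : ℝ) :
    directionalMajorant μ a ω r ≤
      (∫ y, ‖a y‖ * Real.exp (Real.pi / 2 * ‖y‖ ^ 2) ∂μ) * Real.exp (2 * Real.pi * r ^ 2) := by
  rw [← integral_mul_const]
  refine integral_mono (integrable_norm_mul_exp_abs_inner hm ha hω r) (ha.mul_const _) fun y => ?_
  dsimp only
  rw [mul_assoc ‖a y‖]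
  gcongr
  exact exp_two_pi_mul_abs_inner_le hω r y

theorem norm_directionalTransform_le (hm : AEStronglyMeasurable a μ)
    (ha : Integrable (fun y => ‖a y‖ * Real.exp (Real.pi / 2 * ‖y‖ ^ 2)) μ) (hω : ‖ω‖ = 1) (z : ℂ) :
    ‖directionalTransform μ a ω z‖ ≤ directionalMajorant μ a ω |z.im| :=
  norm_integral_le_of_norm_le (integrable_norm_mul_exp_abs_inner hm ha hω |z.im|)
    (.of_forall fun y => norm_mul_cexp_inner_le z y)

theorem differentiable_directionalTransform (hm : AEStronglyMeasurable a μ)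
    (ha : Integrable (fun y => ‖a y‖ * Real.exp (Real.pi / 2 * ‖y‖ ^ 2)) μ) (hω : ‖ω‖ = 1) :
    Differentiable ℂ (directionalTransform μ a ω) := by
  refine differentiable_integral_of_dominated (fun z => ?_) (fun y => by fun_prop) fun R =>
    ⟨_, integrable_norm_mul_exp_abs_inner hm ha hω R, .of_forall fun y z hz => ?_⟩
  · exact hm.mul (Continuous.aestronglyMeasurable (by fun_prop))
  · refine (norm_mul_cexp_inner_le z y).trans ?_
    gcongr
    exact (Complex.abs_im_le_norm z).trans hz

-- The hypothesis has `1 + r + ‖y‖` in the denominator, the one-variable argument needs `1 + r`. By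
-- `exp_inner_div_le` the change costs a constant and a Gaussian term in `r`, integrable against
-- `rⁿ` because the transform is bounded on the real line.
open Set in
theorem integrableOn_directionalTransform_mul_majorant (hm : AEStronglyMeasurable a μ)
    (ha : Integrable (fun y => ‖a y‖ * Real.exp (Real.pi / 2 * ‖y‖ ^ 2)) μ) (hω : ‖ω‖ = 1)
    (n : ℕ) (s : ℝ)
    (hf : ∫⁻ r in Ioi (0 : ℝ), ENNReal.ofReal (‖directionalTransform μ a ω (s * r)‖ * r ^ n) *
      ∫⁻ y, ENNReal.ofReal (‖a y‖ * (Real.exp (2 * Real.pi * r * |inner ℝ ω y|) /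
        (1 + r + ‖y‖) ^ (n + 1))) ∂μ < ⊤) :
    IntegrableOn (fun r : ℝ => ‖directionalTransform μ a ω (s * r)‖ *
      directionalMajorant μ a ω r * r ^ n / (1 + r) ^ (n + 1)) (Ioi 0) := by
  have hgc := (differentiable_directionalTransform hm ha hω).continuous
  have hgb : ∀ r : ℝ, ‖directionalTransform μ a ω (s * r)‖ ≤ directionalMajorant μ a ω 0 :=
    fun r => by simpa using norm_directionalTransform_le hm ha hω (s * r)
  set g := directionalTransform μ a ω
  set M := directionalMajorant μ a ω with hMdef
  set A := ∫ y, ‖a y‖ * Real.exp (Real.pi / 2 * ‖y‖ ^ 2) ∂μ with hA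
  have hMmono : Monotone M := directionalMajorant_monotone hm ha hω
  set J : ℝ → ℝ := fun r => ∫ y, ‖a y‖ * (Real.exp (2 * Real.pi * r * |inner ℝ ω y|) /
        (1 + r + ‖y‖) ^ (n + 1)) ∂μ with hJ
  have hJi : ∀ r : ℝ, 0 < r → Integrable (fun y => ‖a y‖ *
      (Real.exp (2 * Real.pi * r * |inner ℝ ω y|) / (1 + r + ‖y‖) ^ (n + 1))) μ := fun r hr => by
    refine (integrable_norm_mul_exp_abs_inner hm ha hω r).mono' (hm.norm.mul
      (Continuous.aestronglyMeasurable (Continuous.div (by fun_prop) (by fun_prop)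
        fun y => by positivity))) (.of_forall fun y => ?_)
    rw [Real.norm_eq_abs, abs_of_nonneg (by positivity)]
    gcongr
    exact div_le_self (by positivity) (one_le_pow₀ (by linarith [norm_nonneg y]))
  have hMJ : ∀ r : ℝ, 0 < r → M r / (1 + r) ^ (n + 1) ≤
      9 ^ (n + 1) * J r + A * Real.exp (-(r ^ 2)) := fun r hr => by
    rw [hMdef, directionalMajorant, hJ, hA, ← integral_div, ← integral_const_mul,
      ← integral_mul_const, ← integral_add ((hJi r hr).const_mul _) (ha.mul_const _)]
    refine integral_mono ((integrable_norm_mul_exp_abs_inner hm ha hω r).div_const _)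
      (((hJi r hr).const_mul _).add (ha.mul_const _)) fun y => ?_
    have := mul_le_mul_of_nonneg_left (exp_inner_div_le hω (n + 1) hr y) (norm_nonneg (a y))
    dsimp only
    calc _ = ‖a y‖ * (Real.exp (2 * Real.pi * r * |inner ℝ ω y|) / (1 + r) ^ (n + 1)) := by ring
      _ ≤ _ := this
      _ = _ := by ring
  have hJI : IntegrableOn (fun r : ℝ => ‖g (s * r)‖ * r ^ n * (M r / (1 + r) ^ (n + 1)))
      (Ioi 0) := by
    refine ⟨((Continuous.measurable (by fun_prop)).mul
      (hMmono.measurable.div (Continuous.measurable (by fun_prop)))).aestronglyMeasurable, ?_⟩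
    have h3 : ∫⁻ r in Ioi (0 : ℝ), (9 ^ (n + 1) * (ENNReal.ofReal (‖g (s * r)‖ * r ^ n) *
      ∫⁻ y, ENNReal.ofReal (‖a y‖ * (Real.exp (2 * Real.pi * r * |inner ℝ ω y|) /
        (1 + r + ‖y‖) ^ (n + 1))) ∂μ) +
          ENNReal.ofReal (M 0 * A * (r ^ n * Real.exp (-(1 : ℝ) * r ^ 2)))) < ⊤ := by
      have hp : ∫⁻ r in Ioi (0 : ℝ),
          ENNReal.ofReal (M 0 * A * (r ^ n * Real.exp (-(1 : ℝ) * r ^ 2))) < ⊤ := by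
        have := integrable_rpow_mul_exp_neg_mul_sq (b := 1) one_pos (s := n)
          (by linarith [(Nat.cast_nonneg n : (0 : ℝ) ≤ n)])
        simp only [Real.rpow_natCast] at this
        exact (this.const_mul (M 0 * A)).integrableOn.lintegral_lt_top
      rw [lintegral_add_right _ (by fun_prop), lintegral_const_mul' _ _ (by simp)]
      exact ENNReal.add_lt_top.2 ⟨ENNReal.mul_lt_top (by simp) hf, hp⟩
    refine lt_of_le_of_lt (setLIntegral_mono' measurableSet_Ioi fun r (hr : 0 < r) => ?_) h3
    have hM0 : 0 ≤ M r := directionalMajorant_nonneg r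
    have hA0 : 0 ≤ A := integral_nonneg fun y => by positivity
    have hJ0 : 0 ≤ J r := integral_nonneg fun y => by positivity
    rw [← ofReal_integral_eq_lintegral_ofReal (hJi r hr) (.of_forall fun y => by positivity),
      Real.enorm_eq_ofReal (by positivity)]
    have e9 : (9 : ENNReal) ^ (n + 1) = ENNReal.ofReal (9 ^ (n + 1)) := by
      rw [ENNReal.ofReal_pow (by norm_num)]; norm_num
    rw [e9, ← ENNReal.ofReal_mul (by positivity), ← ENNReal.ofReal_mul (by positivity),
      ← ENNReal.ofReal_add (by positivity) (mul_nonneg (mul_nonneg (directionalMajorant_nonneg 0) hA0)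
        (by positivity))]
    refine ENNReal.ofReal_le_ofReal ?_
    calc ‖g (s * r)‖ * r ^ n * (M r / (1 + r) ^ (n + 1))
        ≤ ‖g (s * r)‖ * r ^ n * (9 ^ (n + 1) * J r + A * Real.exp (-(r ^ 2))) := by
          exact mul_le_mul_of_nonneg_left (hMJ r hr) (by positivity)
      _ = 9 ^ (n + 1) * (‖g (s * r)‖ * r ^ n * J r) +
          ‖g (s * r)‖ * A * (r ^ n * Real.exp (-(r ^ 2))) := by ring
      _ ≤ 9 ^ (n + 1) * (‖g (s * r)‖ * r ^ n * J r) +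
          M 0 * A * (r ^ n * Real.exp (-(r ^ 2))) := by
          gcongr
          exact hgb r
      _ = _ := by rw [neg_one_mul]
  refine hJI.congr_fun (fun r _ => ?_) measurableSet_Ioi
  dsimp only
  ring

end Directional

section Directional

variable {E : Type*} [NormedAddCommGroup E] [InnerProductSpace ℝ E] [MeasurableSpace E]
  [BorelSpace E] {μ : Measure E} {a : E → ℂ} {ω : E}

-- For `R ≤ 1` the integrand is bounded by monotonicity of the majorant; for `R ≥ 1` the weighted
-- integral takes over.
open Set in
theorem intervalIntegral_directional_le (hm : AEStronglyMeasurable a μ)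
    (ha : Integrable (fun y => ‖a y‖ * Real.exp (Real.pi / 2 * ‖y‖ ^ 2)) μ) (hω : ‖ω‖ = 1)
    (n : ℕ) (s : ℝ)
    (hf : IntegrableOn (fun r : ℝ => ‖directionalTransform μ a ω (s * r)‖ *
      directionalMajorant μ a ω r * r ^ n / (1 + r) ^ (n + 1)) (Ioi 0)) :
    ∃ B : ℝ, ∀ R : ℝ, 0 ≤ R → ∫ t in (0 : ℝ)..1, ‖directionalTransform μ a ω (s * (t * R : ℝ))‖ *
      directionalMajorant μ a ω (t * R) * t ^ n ≤ B := by
  have hgb : ∀ r : ℝ, ‖directionalTransform μ a ω (s * r)‖ ≤ directionalMajorant μ a ω 0 :=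
    fun r => by simpa using norm_directionalTransform_le hm ha hω (s * r)
  have hM := directionalMajorant_monotone hm ha hω
  have hM0 := fun r => directionalMajorant_nonneg (μ := μ) (a := a) (ω := ω) r
  refine ⟨max (directionalMajorant μ a ω 0 * directionalMajorant μ a ω 1)
    (∫ r in Ioi (0 : ℝ), 2 ^ (n + 1) * (‖directionalTransform μ a ω (s * r)‖ *
      directionalMajorant μ a ω r * r ^ n / (1 + r) ^ (n + 1))), fun R hR => ?_⟩
  rcases le_total R 1 with hR1 | hR1
  · refine le_max_of_le_left ?_
    have h1 := intervalIntegral.norm_integral_le_of_norm_le_const (a := (0 : ℝ)) (b := 1)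
      (f := fun t => ‖directionalTransform μ a ω (s * (t * R : ℝ))‖ *
        directionalMajorant μ a ω (t * R) * t ^ n)
      (C := directionalMajorant μ a ω 0 * directionalMajorant μ a ω 1) (fun t ht => ?_)
    · rw [sub_zero, abs_one, mul_one] at h1
      exact (le_abs_self _).trans h1
    · rw [uIoc_of_le zero_le_one] at ht
      have ht0 := ht.1.le
      have h0 := hM0 (t * R)
      rw [Real.norm_eq_abs, abs_of_nonneg (by positivity)]
      calc _ ≤ directionalMajorant μ a ω 0 * directionalMajorant μ a ω 1 * 1 := by
            gcongr
            · exact mul_nonneg (hM0 0) (hM0 1)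
            · exact hM0 0
            · exact hgb _
            · exact hM (mul_le_one₀ ht.2 hR hR1)
            · exact pow_le_one₀ ht0 ht.2
        _ = _ := mul_one _
  · refine le_max_of_le_right ?_
    exact intervalIntegral_comp_mul_mul_pow_le
      (φ := fun r => ‖directionalTransform μ a ω (s * r)‖ * directionalMajorant μ a ω r)
      (fun r _ => mul_nonneg (norm_nonneg _) (hM0 r)) hf hR1

-- `AxisBound` is applied to `g` and `z ↦ g(iz)`, with the directional majorant for both. The two
-- signs of `s` control both halves of the real axis.
open Set Filter Topology in
theorem directionalTransform_eq_zero (hm : AEStronglyMeasurable a μ)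
    (ha : Integrable (fun y => ‖a y‖ * Real.exp (Real.pi / 2 * ‖y‖ ^ 2)) μ) (hω : ‖ω‖ = 1)
    (n : ℕ)
    (hf : ∀ s : ℝ, |s| = 1 → ∫⁻ r in Ioi (0 : ℝ),
      ENNReal.ofReal (‖directionalTransform μ a ω (s * r)‖ * r ^ n) *
      ∫⁻ y, ENNReal.ofReal (‖a y‖ * (Real.exp (2 * Real.pi * r * |inner ℝ ω y|) /
        (1 + r + ‖y‖) ^ (n + 1))) ∂μ < ⊤) (z : ℂ) :
    directionalTransform μ a ω z = 0 := by
  have hint := fun s hs => integrableOn_directionalTransform_mul_majorant hm ha hω n s (hf s hs)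
  obtain ⟨B₁, hB₁⟩ := intervalIntegral_directional_le hm ha hω n 1 (hint 1 (by simp))
  obtain ⟨B₂, hB₂⟩ := intervalIntegral_directional_le hm ha hω n (-1) (hint (-1) (by simp))
  have hd := differentiable_directionalTransform hm ha hω
  have hle := norm_directionalTransform_le hm ha hω
  have hbound : ∀ R : ℝ, ∫ t in (0 : ℝ)..1, ‖directionalTransform μ a ω (t * R)‖ *
      directionalMajorant μ a ω (t * |R|) * t ^ n ≤ max B₁ B₂ := fun R => by
    rcases le_total 0 R with hR | hR
    · refine le_max_of_le_left ?_
      simpa [abs_of_nonneg hR] using hB₁ R hR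
    · refine le_max_of_le_right ?_
      simpa [abs_of_nonpos hR] using hB₂ (-R) (by linarith)
  have hax : AxisBound (directionalTransform μ a ω)
      (fun z => directionalTransform μ a ω (Complex.I * z)) (directionalMajorant μ a ω) n
      (max B₁ B₂) :=
    { diff_left := hd
      diff_right := hd.comp (by fun_prop)
      mono := directionalMajorant_monotone hm ha hω
      norm_left_le := hle
      norm_right_le := fun z => by simpa using hle (Complex.I * z)
      integral_left_le := hbound
      integral_right_le := fun R => by
        have e : ∀ t : ℝ, Complex.I * (t * R * Complex.I) = t * ((-R : ℝ) : ℂ) := fun t => by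
          push_cast
          linear_combination (t * R : ℂ) * Complex.I_mul_I
        simp only [e]
        simpa using hbound (-R) }
  refine eq_zero_of_mul_rotate_eq_zero hd (fun R hR => hax.mul_eq_zero
    (fun r _ => directionalMajorant_le hm ha hω r) ?_ hR) z
  have := tendsto_intervalIntegral_comp_mul_mul_pow
    (φ := fun r => ‖directionalTransform μ a ω ((1 : ℝ) * r)‖ * directionalMajorant μ a ω r)
    (fun r _ => mul_nonneg (norm_nonneg _) (directionalMajorant_nonneg r)) (hint 1 (by simp))
  simpa using this

end Directional

/-! ### Polar coordinates: from lines to the whole space. -/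

section Polar

variable {E : Type*} [NormedAddCommGroup E] [InnerProductSpace ℝ E] [FiniteDimensional ℝ E]
  [MeasurableSpace E] [BorelSpace E] {μ : Measure E} [μ.IsAddHaarMeasure]

open Set Metric Module in
theorem lintegral_eq_lintegral_toSphere [Nontrivial E] (Φ : E → ENNReal) (hΦ : Measurable Φ) :
    ∫⁻ x, Φ x ∂μ = ∫⁻ ω : sphere (0 : E) 1, (∫⁻ r in Ioi (0 : ℝ),
      ENNReal.ofReal (r ^ (finrank ℝ E - 1)) * Φ (r • (ω : E))) ∂μ.toSphere := by
  have h := μ.measurePreserving_homeomorphUnitSphereProd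
  have hΨ : Measurable fun z : sphere (0 : E) 1 × Ioi (0 : ℝ) => Φ ((z.2 : ℝ) • (z.1 : E)) :=
    hΦ.comp (by fun_prop)
  have h1 : ∫⁻ x, Φ x ∂μ = ∫⁻ x : ({0}ᶜ : Set E), Φ x ∂(μ.comap (↑)) := by
    rw [lintegral_subtype_comap (measurableSet_singleton _).compl, restrict_compl_singleton]
  rw [h1]
  have h2 := h.lintegral_comp hΨ
  have h3 : ∀ x : ({0}ᶜ : Set E), (((homeomorphUnitSphereProd E) x).2 : ℝ) •
      (((homeomorphUnitSphereProd E) x).1 : E) = x := fun x => by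
    have hx : ‖(x : E)‖ ≠ 0 := norm_ne_zero_iff.2 x.2
    simp [smul_smul, hx]
  simp only [h3] at h2
  rw [h2, lintegral_prod _ hΨ.aemeasurable]
  refine lintegral_congr fun ω => ?_
  have hω : Measurable fun r : Ioi (0 : ℝ) => Φ ((r : ℝ) • (ω : E)) := hΦ.comp (by fun_prop)
  rw [Measure.volumeIoiPow, lintegral_withDensity_eq_lintegral_mul _ (by fun_prop) hω]
  exact lintegral_subtype_comap (measurableSet_Ioi)
    (fun r : ℝ => ENNReal.ofReal (r ^ (finrank ℝ E - 1)) * Φ (r • (ω : E)))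

/-- The inverse Fourier integral `x ↦ ∫ a(y) e^{2π i ⟨x, y⟩} dy`. -/
noncomputable def inverseFourierIntegral (μ : Measure E) (a : E → ℂ) (x : E) : ℂ :=
  ∫ y, a y * Complex.exp (2 * Real.pi * Complex.I * (inner ℝ x y : ℝ)) ∂μ

omit [FiniteDimensional ℝ E] [BorelSpace E] [μ.IsAddHaarMeasure] in
theorem inverseFourierIntegral_smul (a : E → ℂ) (ω : E) (r : ℝ) :
    inverseFourierIntegral μ a (r • ω) = directionalTransform μ a ω r := by
  unfold inverseFourierIntegral directionalTransform
  congr 1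
  ext y
  rw [inner_smul_left]
  simp only [conj_trivial]
  push_cast
  ring_nf

theorem stronglyMeasurable_inverseFourierIntegral {a : E → ℂ} (ha : StronglyMeasurable a) :
    StronglyMeasurable (inverseFourierIntegral μ a) := by
  unfold inverseFourierIntegral
  refine StronglyMeasurable.integral_prod_right' (ν := μ)
    (f := fun z : E × E => a z.2 * Complex.exp (2 * Real.pi * Complex.I * (inner ℝ z.1 z.2 : ℝ))) ?_
  exact (ha.comp_measurable measurable_snd).mul (Continuous.stronglyMeasurable (by fun_prop))

open Set Metric Module in
theorem inverseFourierIntegral_ae_eq_zero [Nontrivial E] {a : E → ℂ} (hm : StronglyMeasurable a)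
    (ha : Integrable (fun y => ‖a y‖ * Real.exp (Real.pi / 2 * ‖y‖ ^ 2)) μ)
    (hf : ∫⁻ x, ENNReal.ofReal ‖inverseFourierIntegral μ a x‖ *
      ∫⁻ y, ENNReal.ofReal (‖a y‖ * (Real.exp (2 * Real.pi * |inner ℝ x y|) /
        (1 + ‖x‖ + ‖y‖) ^ finrank ℝ E)) ∂μ ∂μ < ⊤) :
    inverseFourierIntegral μ a =ᵐ[μ] 0 := by
  have hGm := (stronglyMeasurable_inverseFourierIntegral (μ := μ) hm)
  have hn : finrank ℝ E - 1 + 1 = finrank ℝ E := Nat.sub_add_cancel finrank_pos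
  set G := inverseFourierIntegral μ a with hG
  set n := finrank ℝ E - 1
  rw [← hn] at hf
  set W : E → ENNReal := fun x => ∫⁻ y, ENNReal.ofReal (‖a y‖ *
    (Real.exp (2 * Real.pi * |inner ℝ x y|) / (1 + ‖x‖ + ‖y‖) ^ (n + 1))) ∂μ with hW
  have hWm : Measurable W := by
    refine Measurable.lintegral_prod_right' (ν := μ) (f := fun z : E × E => ENNReal.ofReal (‖a z.2‖ *
      (Real.exp (2 * Real.pi * |inner ℝ z.1 z.2|) / (1 + ‖z.1‖ + ‖z.2‖) ^ (n + 1)))) ?_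
    refine ((hm.measurable.comp measurable_snd).norm.mul ?_).ennreal_ofReal
    refine Measurable.div (Continuous.measurable (by fun_prop)) (Continuous.measurable (by fun_prop))
  have hfin : ∀ s : ℝ, |s| = 1 → ∀ᵐ ω : sphere (0 : E) 1 ∂μ.toSphere, ∫⁻ r in Ioi (0 : ℝ),
      ENNReal.ofReal (r ^ n) * (ENNReal.ofReal ‖G (s • r • (ω : E))‖ * W (r • (ω : E))) < ⊤ := by
    intro s hs
    have hΦ : Measurable fun x => ENNReal.ofReal ‖G (s • x)‖ * W x :=
      (hGm.measurable.comp (measurable_const_smul s)).norm.ennreal_ofReal.mul hWm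
    have h1 : ∫⁻ x, ENNReal.ofReal ‖G (s • x)‖ * W x ∂μ < ⊤ := by
      rcases eq_or_eq_neg_of_abs_eq hs with rfl | rfl
      · simpa [hW] using hf
      -- The weight `W` is even, so reflection reduces `s = -1` to the hypothesis.
      · rw [← lintegral_neg_eq_self]
        simpa [hW] using hf
    rw [lintegral_eq_lintegral_toSphere _ hΦ] at h1
    refine ae_lt_top ?_ h1.ne
    refine Measurable.lintegral_prod_right' (ν := volume.restrict (Ioi (0 : ℝ)))
      (f := fun z : sphere (0 : E) 1 × ℝ => ENNReal.ofReal (z.2 ^ n) *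
        (ENNReal.ofReal ‖G (s • z.2 • (z.1 : E))‖ * W (z.2 • (z.1 : E)))) ?_
    refine Measurable.mul (by fun_prop) (hΦ.comp (g := fun x => ENNReal.ofReal ‖G (s • x)‖ * W x)
      (f := fun z : sphere (0 : E) 1 × ℝ => z.2 • (z.1 : E)) (by fun_prop))
  have hzero : ∀ᵐ ω : sphere (0 : E) 1 ∂μ.toSphere, ∀ r : ℝ, G (r • (ω : E)) = 0 := by
    filter_upwards [hfin 1 (by simp), hfin (-1) (by simp)] with ω h1 h2 r
    have hω : ‖(ω : E)‖ = 1 := by simp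
    rw [hG, inverseFourierIntegral_smul]
    refine directionalTransform_eq_zero hm.aestronglyMeasurable ha hω n (fun s hs => ?_) r
    have h3 : ∫⁻ r in Ioi (0 : ℝ), ENNReal.ofReal (r ^ n) *
        (ENNReal.ofReal ‖G (s • r • (ω : E))‖ * W (r • (ω : E))) < ⊤ := by
      rcases eq_or_eq_neg_of_abs_eq hs with rfl | rfl
      exacts [h1, h2]
    refine (setLIntegral_congr_fun measurableSet_Ioi fun r hr => ?_).trans_lt h3
    have hr : 0 < r := hr
    rw [smul_smul, hG, inverseFourierIntegral_smul, ENNReal.ofReal_mul (norm_nonneg _), ← mul_assoc,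
      mul_comm (ENNReal.ofReal (r ^ n)), Complex.ofReal_mul, hW]
    congr 1
    refine lintegral_congr fun y => ?_
    rw [inner_smul_left, norm_smul, hω, Real.norm_eq_abs, abs_of_pos hr, abs_mul]
    simp [abs_of_pos hr, mul_assoc]
  have hint : ∫⁻ x, ENNReal.ofReal ‖G x‖ ∂μ = 0 := by
    rw [lintegral_eq_lintegral_toSphere _ hGm.measurable.norm.ennreal_ofReal]
    refine lintegral_eq_zero_of_ae_eq_zero (hzero.mono fun ω hω => ?_)
    simp [hω]
  have := (lintegral_eq_zero_iff hGm.measurable.norm.ennreal_ofReal).1 hint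
  filter_upwards [this] with x hx
  simpa using hx

end Polar

/-! ### Gaussian smoothing and Beurling's theorem in critical form. -/

section Beurling

variable {E : Type*} [NormedAddCommGroup E] [InnerProductSpace ℝ E]

/-- Completing the square gives one of the two Gaussians, according to the sign of the inner
product. -/
theorem gaussian_mul_exp_inner_le (s y : E) :
    Real.exp (-Real.pi * ‖s‖ ^ 2) * Real.exp (-Real.pi * ‖y‖ ^ 2) *
      Real.exp (2 * Real.pi * |inner ℝ s y|) ≤
      Real.exp (-Real.pi * ‖s - y‖ ^ 2) + Real.exp (-Real.pi * ‖s + y‖ ^ 2) := by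
  rw [← Real.exp_add, ← Real.exp_add]
  rcases le_total 0 (inner ℝ s y) with h | h
  · refine le_add_of_le_of_nonneg (Real.exp_le_exp.2 (le_of_eq ?_)) (Real.exp_pos _).le
    rw [abs_of_nonneg h, norm_sub_sq_real]; ring
  · refine le_add_of_nonneg_of_le (Real.exp_pos _).le (Real.exp_le_exp.2 (le_of_eq ?_))
    rw [abs_of_nonpos h, norm_add_sq_real]; ring

omit [InnerProductSpace ℝ E] in
theorem one_add_pow_div_le (k : ℕ) (x s y : E) :
    1 / (1 + ‖x + s‖ + ‖y‖) ^ k ≤ 2 ^ k * (1 + ‖s - y‖) ^ k / (1 + ‖x‖ + ‖y‖) ^ k := by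
  rw [div_le_div_iff₀ (by positivity) (by positivity), one_mul, ← mul_pow, ← mul_pow]
  gcongr
  have h1 : ‖x‖ ≤ ‖x + s‖ + ‖s‖ := by simpa using norm_sub_le (x + s) s
  have h2 : ‖s‖ ≤ ‖s - y‖ + ‖y‖ := by simpa using norm_add_le (s - y) y
  nlinarith [norm_nonneg (x + s), norm_nonneg y, norm_nonneg (s - y),
    mul_nonneg (norm_nonneg (s - y)) (norm_nonneg y),
    mul_nonneg (norm_nonneg (s - y)) (norm_nonneg (x + s))]

/-- The Gaussian with polynomial weight `(1 + ‖x‖)ᵏ e^{-π ‖x‖²}`. -/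
noncomputable def weightedGaussian (k : ℕ) (x : E) : ℝ :=
  (1 + ‖x‖) ^ k * Real.exp (-Real.pi * ‖x‖ ^ 2)

theorem smoothing_kernel_le (k : ℕ) (x s y : E) :
    Real.exp (-Real.pi * ‖s‖ ^ 2) * (Real.exp (-Real.pi * ‖y‖ ^ 2) *
      (Real.exp (2 * Real.pi * |inner ℝ (x + s) y|) / (1 + ‖x + s‖ + ‖y‖) ^ k)) ≤
      Real.exp (2 * Real.pi * |inner ℝ x y|) / (1 + ‖x‖ + ‖y‖) ^ k *
        (2 ^ k * (weightedGaussian k (s - y) + weightedGaussian k (s + y))) := by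
  have h1 : Real.exp (2 * Real.pi * |inner ℝ (x + s) y|) ≤
      Real.exp (2 * Real.pi * |inner ℝ x y|) * Real.exp (2 * Real.pi * |inner ℝ s y|) := by
    rw [← Real.exp_add, ← mul_add, inner_add_left]
    gcongr
    exact abs_add_le _ _
  have h2 := one_add_pow_div_le k x s y
  have h3 := one_add_pow_div_le k x s (-y)
  rw [norm_neg, sub_neg_eq_add] at h3
  have h4 := gaussian_mul_exp_inner_le s y
  set D := 1 / (1 + ‖x + s‖ + ‖y‖) ^ k
  have hD : 0 ≤ D := by positivity
  calc _ = Real.exp (-Real.pi * ‖s‖ ^ 2) * Real.exp (-Real.pi * ‖y‖ ^ 2) *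
        Real.exp (2 * Real.pi * |inner ℝ (x + s) y|) * D := by ring
    _ ≤ Real.exp (-Real.pi * ‖s‖ ^ 2) * Real.exp (-Real.pi * ‖y‖ ^ 2) *
        (Real.exp (2 * Real.pi * |inner ℝ x y|) * Real.exp (2 * Real.pi * |inner ℝ s y|)) * D := by
      gcongr
    _ = Real.exp (2 * Real.pi * |inner ℝ x y|) * ((Real.exp (-Real.pi * ‖s‖ ^ 2) *
        Real.exp (-Real.pi * ‖y‖ ^ 2) * Real.exp (2 * Real.pi * |inner ℝ s y|)) * D) := by ring
    _ ≤ Real.exp (2 * Real.pi * |inner ℝ x y|) * ((Real.exp (-Real.pi * ‖s - y‖ ^ 2) +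
        Real.exp (-Real.pi * ‖s + y‖ ^ 2)) * D) := by gcongr
    _ = Real.exp (2 * Real.pi * |inner ℝ x y|) * (Real.exp (-Real.pi * ‖s - y‖ ^ 2) * D +
        Real.exp (-Real.pi * ‖s + y‖ ^ 2) * D) := by ring
    _ ≤ Real.exp (2 * Real.pi * |inner ℝ x y|) * (Real.exp (-Real.pi * ‖s - y‖ ^ 2) *
          (2 ^ k * (1 + ‖s - y‖) ^ k / (1 + ‖x‖ + ‖y‖) ^ k) +
        Real.exp (-Real.pi * ‖s + y‖ ^ 2) *
          (2 ^ k * (1 + ‖s + y‖) ^ k / (1 + ‖x‖ + ‖y‖) ^ k)) := by gcongr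
    _ = _ := by unfold weightedGaussian; ring

variable [FiniteDimensional ℝ E] [MeasurableSpace E] [BorelSpace E]

theorem integrable_exp_neg_mul_norm_sq {b : ℝ} (hb : 0 < b) :
    Integrable fun x : E => Real.exp (-b * ‖x‖ ^ 2) := by
  have := (GaussianFourier.integrable_cexp_neg_mul_sq_norm_add (V := E) (b := b)
    (by simpa using hb) 0 0).norm
  refine this.congr (.of_forall fun x => ?_)
  simp only [Complex.norm_exp]
  congr 1
  simp [← Complex.ofReal_pow]

theorem integrable_weightedGaussian (k : ℕ) : Integrable (weightedGaussian (E := E) k) := by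
  refine ((integrable_exp_neg_mul_norm_sq (E := E) (half_pos Real.pi_pos)).const_mul
    (Real.exp (k ^ 2))).mono' (Continuous.aestronglyMeasurable (by
      unfold weightedGaussian; fun_prop)) (.of_forall fun x => ?_)
  unfold weightedGaussian
  rw [Real.norm_eq_abs, abs_of_nonneg (by positivity)]
  have h1 : (1 + ‖x‖) ^ k ≤ Real.exp (k * ‖x‖) := by
    rw [Real.exp_nat_mul]
    gcongr
    rw [add_comm]
    exact Real.add_one_le_exp _
  calc _ ≤ Real.exp (k * ‖x‖) * Real.exp (-Real.pi * ‖x‖ ^ 2) := by gcongr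
    _ ≤ _ := by
      rw [← Real.exp_add, ← Real.exp_add]
      refine Real.exp_le_exp.2 ?_
      nlinarith [Real.pi_gt_three, sq_nonneg ((k : ℝ) - ‖x‖), sq_nonneg (k : ℝ), sq_nonneg ‖x‖,
        mul_nonneg (sub_nonneg.2 Real.pi_gt_three.le) (sq_nonneg ‖x‖)]

/-- With `x = x' + s`, the smoothing error is a weighted Gaussian in `s` centred at `y` or `-y`. Its
integral does not depend on `y` by translation invariance, so only the kernel at `x'` is left. -/
theorem lintegral_smoothing_kernel_le (k : ℕ) (x' y : E) :
    ∫⁻ x, ENNReal.ofReal (Real.exp (-Real.pi * ‖x - x'‖ ^ 2)) *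
      ENNReal.ofReal (Real.exp (-Real.pi * ‖y‖ ^ 2) *
        (Real.exp (2 * Real.pi * |inner ℝ x y|) / (1 + ‖x‖ + ‖y‖) ^ k)) ≤
      ENNReal.ofReal (Real.exp (2 * Real.pi * |inner ℝ x' y|) / (1 + ‖x'‖ + ‖y‖) ^ k) *
        (2 ^ k * (2 * ∫⁻ s : E, ENNReal.ofReal (weightedGaussian k s))) := by
  have hmeas : Measurable fun s : E => ENNReal.ofReal (weightedGaussian k s) :=
    (Continuous.measurable (by unfold weightedGaussian; fun_prop)).ennreal_ofReal
  rw [← lintegral_add_right_eq_self _ x']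
  calc _ ≤ ∫⁻ s, ENNReal.ofReal (Real.exp (2 * Real.pi * |inner ℝ x' y|) / (1 + ‖x'‖ + ‖y‖) ^ k) *
        (2 ^ k * (ENNReal.ofReal (weightedGaussian k (s - y)) +
          ENNReal.ofReal (weightedGaussian k (s + y)))) := by
        refine lintegral_mono fun s => ?_
        have hw : ∀ z : E, 0 ≤ weightedGaussian k z := fun z => by
          unfold weightedGaussian; positivity
        have e2 : (2 : ENNReal) ^ k = ENNReal.ofReal (2 ^ k) := by
          rw [ENNReal.ofReal_pow (by norm_num)]; norm_num
        rw [← ENNReal.ofReal_mul (by positivity), e2, ← ENNReal.ofReal_add (hw _) (hw _),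
          ← ENNReal.ofReal_mul (by positivity), ← ENNReal.ofReal_mul (by positivity),
          add_sub_cancel_right, add_comm s x']
        exact ENNReal.ofReal_le_ofReal (smoothing_kernel_le k x' s y)
    _ = _ := by
        rw [lintegral_const_mul' _ _ (by simp), lintegral_const_mul' _ _ (by simp),
          lintegral_add_right (g := fun s => ENNReal.ofReal (weightedGaussian k (s + y))) _
            (hmeas.comp (measurable_id.add_const y)),
          lintegral_sub_right_eq_self (fun s => ENNReal.ofReal (weightedGaussian k s)),
          lintegral_add_right_eq_self (fun s => ENNReal.ofReal (weightedGaussian k s)),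
          two_mul (lintegral _ _)]

/-- Gaussian smoothing preserves Beurling's integrability condition. -/
theorem lintegral_smoothing_lt_top (k : ℕ) {u v G : E → ℂ} (hu : StronglyMeasurable u)
    (hv : StronglyMeasurable v)
    (hG : ∀ x, ENNReal.ofReal ‖G x‖ ≤
      ∫⁻ x', ENNReal.ofReal ‖u x'‖ * ENNReal.ofReal (Real.exp (-Real.pi * ‖x - x'‖ ^ 2)))
    (h : ∫⁻ x, ∫⁻ y, ENNReal.ofReal ‖u x‖ * ENNReal.ofReal ‖v y‖ *
      ENNReal.ofReal (Real.exp (2 * Real.pi * |inner ℝ x y|) / (1 + ‖x‖ + ‖y‖) ^ k) < ⊤) :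
    ∫⁻ x, ENNReal.ofReal ‖G x‖ * ∫⁻ y, ENNReal.ofReal (‖v y * Real.exp (-Real.pi * ‖y‖ ^ 2)‖ *
      (Real.exp (2 * Real.pi * |inner ℝ x y|) / (1 + ‖x‖ + ‖y‖) ^ k)) < ⊤ := by
  have hC : ∫⁻ s : E, ENNReal.ofReal (weightedGaussian k s) < ⊤ :=
    (integrable_weightedGaussian k).lintegral_lt_top
  set C := ∫⁻ s : E, ENNReal.ofReal (weightedGaussian k s)
  set κ : E → E → E → ENNReal := fun x x' y =>
    ENNReal.ofReal ‖u x'‖ * ENNReal.ofReal ‖v y‖ *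
      (ENNReal.ofReal (Real.exp (-Real.pi * ‖x - x'‖ ^ 2)) *
      ENNReal.ofReal (Real.exp (-Real.pi * ‖y‖ ^ 2) *
        (Real.exp (2 * Real.pi * |inner ℝ x y|) / (1 + ‖x‖ + ‖y‖) ^ k))) with hκ
  have hk : Measurable fun z : E × E => ENNReal.ofReal (Real.exp (-Real.pi * ‖z.2‖ ^ 2) *
        (Real.exp (2 * Real.pi * |inner ℝ z.1 z.2|) / (1 + ‖z.1‖ + ‖z.2‖) ^ k)) := by
    refine Measurable.ennreal_ofReal (Measurable.mul (by fun_prop) (Measurable.div ?_ ?_)) <;>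
    exact Continuous.measurable (by fun_prop)
  have hun : Measurable fun x => ENNReal.ofReal ‖u x‖ := hu.measurable.norm.ennreal_ofReal
  have hvn : Measurable fun x => ENNReal.ofReal ‖v x‖ := hv.measurable.norm.ennreal_ofReal
  have hκm : Measurable fun z : E × E × E => κ z.1 z.2.1 z.2.2 := by
    refine Measurable.mul (Measurable.mul (hun.comp (by fun_prop)) (hvn.comp (by fun_prop)))
      (Measurable.mul (by fun_prop) (hk.comp (g := fun z : E × E => _)
        (f := fun z : E × E × E => (z.1, z.2.2)) (by fun_prop)))
  have h1 : ∀ x, ENNReal.ofReal ‖G x‖ *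
      ∫⁻ y, ENNReal.ofReal (‖v y * Real.exp (-Real.pi * ‖y‖ ^ 2)‖ *
        (Real.exp (2 * Real.pi * |inner ℝ x y|) / (1 + ‖x‖ + ‖y‖) ^ k)) ≤
      ∫⁻ z : E × E, κ x z.1 z.2 := fun x => by
    have hkx : Measurable fun y : E => ENNReal.ofReal (Real.exp (-Real.pi * ‖y‖ ^ 2) *
        (Real.exp (2 * Real.pi * |inner ℝ x y|) / (1 + ‖x‖ + ‖y‖) ^ k)) :=
      hk.comp (f := fun y : E => (x, y)) (by fun_prop)
    refine (mul_le_mul' (hG x) (le_of_eq ?_)).trans (le_of_eq (lintegral_prod_mul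
      (μ := volume) (ν := volume)
      (f := fun x' => ENNReal.ofReal ‖u x'‖ * ENNReal.ofReal (Real.exp (-Real.pi * ‖x - x'‖ ^ 2)))
      (g := fun y => ENNReal.ofReal ‖v y‖ * ENNReal.ofReal (Real.exp (-Real.pi * ‖y‖ ^ 2) *
        (Real.exp (2 * Real.pi * |inner ℝ x y|) / (1 + ‖x‖ + ‖y‖) ^ k))) ?_ ?_).symm |>.trans ?_)
    · refine lintegral_congr fun y => ?_
      rw [← ENNReal.ofReal_mul (norm_nonneg _), norm_mul, Complex.norm_real, Real.norm_eq_abs,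
        Real.abs_exp, mul_assoc]
    · exact (hun.mul (by fun_prop)).aemeasurable
    · exact (hvn.mul hkx).aemeasurable
    · refine le_of_eq (lintegral_congr fun z => ?_)
      simp only [hκ]
      ring
  calc _ ≤ ∫⁻ x, ∫⁻ z : E × E, κ x z.1 z.2 := lintegral_mono h1
    _ = ∫⁻ z : E × E, ∫⁻ x, κ x z.1 z.2 := lintegral_lintegral_swap hκm.aemeasurable
    _ ≤ ∫⁻ z : E × E, ENNReal.ofReal ‖u z.1‖ * ENNReal.ofReal ‖v z.2‖ *
        ENNReal.ofReal (Real.exp (2 * Real.pi * |inner ℝ z.1 z.2|) / (1 + ‖z.1‖ + ‖z.2‖) ^ k) *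
          (2 ^ k * (2 * C)) := by
        refine lintegral_mono fun z => ?_
        simp only [hκ]
        rw [lintegral_const_mul' _ _ (by simp [ENNReal.mul_eq_top]), mul_assoc _ _ (2 ^ k * (2 * C))]
        exact mul_le_mul_right (lintegral_smoothing_kernel_le k z.1 z.2) _
    _ = (∫⁻ z : E × E, ENNReal.ofReal ‖u z.1‖ * ENNReal.ofReal ‖v z.2‖ *
        ENNReal.ofReal (Real.exp (2 * Real.pi * |inner ℝ z.1 z.2|) / (1 + ‖z.1‖ + ‖z.2‖) ^ k)) *
          (2 ^ k * (2 * C)) := by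
        rw [lintegral_mul_const']
        exact ENNReal.mul_ne_top (by simp) (ENNReal.mul_ne_top (by simp) hC.ne)
    _ < ⊤ := by
        refine ENNReal.mul_lt_top ?_
          (ENNReal.mul_lt_top (by simp) (ENNReal.mul_lt_top (by simp) hC))
        rw [Measure.volume_eq_prod, lintegral_prod]
        · exact h
        · refine (((hun.comp measurable_fst).mul (hvn.comp measurable_snd)).mul ?_).aemeasurable
          refine (Measurable.div ?_ ?_).ennreal_ofReal <;> exact Continuous.measurable (by fun_prop)

open FourierTransform in
/-- An integrable function with vanishing inverse Fourier integral is zero. -/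
theorem ae_eq_zero_of_inverseFourierIntegral {a : E → ℂ} (ha : Integrable a)
    (h : inverseFourierIntegral volume a =ᵐ[volume] 0) : a =ᵐ[volume] 0 := by
  -- A test function is the Fourier transform of a Schwartz function, so the multiplication formula
  -- moves the transform onto `a`.
  refine ae_eq_zero_of_integral_contDiff_smul_eq_zero ha.locallyIntegrable fun g hg hgc => ?_
  have hgc' : HasCompactSupport fun x => (g x : ℂ) := hgc.comp_left Complex.ofReal_zero
  have hg' : ContDiff ℝ (⊤ : ℕ∞) fun x => (g x : ℂ) := Complex.ofRealCLM.contDiff.comp hg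
  set φ : 𝓢(E, ℂ) := hgc'.toSchwartzMap hg' with hφ
  have h1 := VectorFourier.integral_fourierIntegral_smul_eq_flip (L := innerₗ E) (μ := volume)
    (ν := volume) (e := Real.fourierChar) (f := (𝓕⁻ φ : 𝓢(E, ℂ))) (g := a)
    Real.continuous_fourierChar continuous_inner (𝓕⁻ φ).integrable ha
  have h2 : ∀ ξ, VectorFourier.fourierIntegral Real.fourierChar volume (innerₗ E)
      (𝓕⁻ φ : 𝓢(E, ℂ)) ξ = g ξ := fun ξ => by
    have : (𝓕 (𝓕⁻ φ) : 𝓢(E, ℂ)) ξ = φ ξ := by rw [FourierTransform.fourier_fourierInv_eq]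
    rw [SchwartzMap.fourier_coe] at this
    exact this
  simp only [h2, smul_eq_mul] at h1
  simp only [Complex.real_smul]
  rw [h1]
  have h3 : ∀ᵐ x : E, inverseFourierIntegral volume a (-x) = 0 :=
    (Measure.measurePreserving_neg volume).quasiMeasurePreserving.ae h
  rw [← integral_zero E ℂ]
  refine integral_congr_ae (h3.mono fun x hx => ?_)
  have : VectorFourier.fourierIntegral Real.fourierChar volume (innerₗ E).flip a x =
      inverseFourierIntegral volume a (-x) := by
    unfold VectorFourier.fourierIntegral inverseFourierIntegral
    refine integral_congr_ae (.of_forall fun y => ?_)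
    simp only [LinearMap.flip_apply, innerₗ_apply_apply, Circle.smul_def, Real.fourierChar_apply,
      smul_eq_mul, inner_neg_left]
    rw [mul_comm]
    congr 2
    push_cast
    ring
  simp only [this, hx, mul_zero]

/-- Beurling's uncertainty principle with the critical polynomial weight. -/
theorem beurling_ae_eq_zero [Nontrivial E] {u v : E → ℂ} (hu : StronglyMeasurable u)
    (hv : StronglyMeasurable v)
    (hvi : Integrable fun y => ‖v y‖ * Real.exp (-(Real.pi / 2) * ‖y‖ ^ 2))
    (hG : ∀ x, ENNReal.ofReal ‖inverseFourierIntegral volume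
        (fun y => v y * Real.exp (-Real.pi * ‖y‖ ^ 2)) x‖ ≤
      ∫⁻ x', ENNReal.ofReal ‖u x'‖ * ENNReal.ofReal (Real.exp (-Real.pi * ‖x - x'‖ ^ 2)))
    (h : ∫⁻ x, ∫⁻ y, ENNReal.ofReal ‖u x‖ * ENNReal.ofReal ‖v y‖ *
      ENNReal.ofReal (Real.exp (2 * Real.pi * |inner ℝ x y|) /
        (1 + ‖x‖ + ‖y‖) ^ Module.finrank ℝ E) < ⊤) :
    v =ᵐ[volume] 0 := by
  have hm : StronglyMeasurable fun y => v y * Real.exp (-Real.pi * ‖y‖ ^ 2) :=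
    hv.mul (Continuous.stronglyMeasurable (by fun_prop))
  have hnorm : ∀ y, ‖v y * Real.exp (-Real.pi * ‖y‖ ^ 2)‖ =
      ‖v y‖ * Real.exp (-Real.pi * ‖y‖ ^ 2) := fun y => by
    rw [norm_mul, Complex.norm_real, Real.norm_eq_abs, Real.abs_exp]
  have hae := inverseFourierIntegral_ae_eq_zero hm (by
    refine hvi.congr (.of_forall fun y => ?_)
    simp only [hnorm]
    rw [mul_assoc, ← Real.exp_add]
    congr 2; ring) (lintegral_smoothing_lt_top _ hu hv hG h)
  have hint : Integrable fun y => v y * Real.exp (-Real.pi * ‖y‖ ^ 2) := by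
    refine hvi.mono' hm.aestronglyMeasurable (.of_forall fun y => ?_)
    rw [hnorm]
    gcongr
    linarith [Real.pi_pos]
  refine (ae_eq_zero_of_inverseFourierIntegral hint hae).mono fun y hy => ?_
  simpa [Real.exp_ne_zero] using hy

end Beurling

/-! ### Passive variables: slicing and recovery from rectangles. -/

/-- A real integrable function on a product whose integral over every measurable rectangle vanishes
is zero. -/
theorem MeasureTheory.Integrable.ae_eq_zero_of_setIntegral_prod_eq_zero {α β : Type*} [MeasurableSpace α]
    [MeasurableSpace β] {μ : Measure (α × β)} [SigmaFinite μ] {h : α × β → ℝ} (hi : Integrable h μ)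
    (h0 : ∀ (S : Set α) (A : Set β), MeasurableSet S → MeasurableSet A →
      ∫ z in S ×ˢ A, h z ∂μ = 0) : h =ᵐ[μ] 0 := by
  have hfin := fun h : α × β → ℝ => fun hi : Integrable h μ => isFiniteMeasure_withDensity_ofReal
    hi.hasFiniteIntegral
  have := hfin h hi
  -- The positive and negative parts define finite measures agreeing on rectangles, hence equal.
  have heq : μ.withDensity (fun z => ENNReal.ofReal (h z)) =
      μ.withDensity (fun z => ENNReal.ofReal (-h z)) := by
    refine Measure.ext_prod fun {S A} hS hA => ?_
    rw [withDensity_apply _ (hS.prod hA), withDensity_apply _ (hS.prod hA)]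
    have h1 := integral_eq_lintegral_pos_part_sub_lintegral_neg_part (hi.restrict (s := S ×ˢ A))
    rw [h0 S A hS hA, eq_comm, sub_eq_zero] at h1
    exact (ENNReal.toReal_eq_toReal_iff' (hi.restrict).lintegral_lt_top.ne
      (hi.neg.restrict).lintegral_lt_top.ne).1 h1
  have hae := (withDensity_eq_iff hi.aemeasurable.ennreal_ofReal hi.neg.aemeasurable.ennreal_ofReal
    hi.lintegral_lt_top.ne).1 heq
  filter_upwards [hae] with z hz
  have hz' : ENNReal.ofReal (h z) = ENNReal.ofReal (-h z) := hz
  rcases le_total 0 (h z) with h2 | h2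
  · rw [ENNReal.ofReal_of_nonpos (neg_nonpos.2 h2), ENNReal.ofReal_eq_zero] at hz'
    exact le_antisymm hz' h2
  · rw [ENNReal.ofReal_of_nonpos h2, eq_comm, ENNReal.ofReal_eq_zero] at hz'
    exact le_antisymm h2 (neg_nonpos.1 hz')

section Product

variable {E : Type*} [NormedAddCommGroup E] [InnerProductSpace ℝ E] [FiniteDimensional ℝ E]
  [MeasurableSpace E] [BorelSpace E] {T : Type*} [MeasurableSpace T] {ν : Measure T} [SigmaFinite ν]

theorem MeasureTheory.MemLp.mul_tensor {α β : Type*} [MeasurableSpace α] [MeasurableSpace β] {μ : Measure α}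
    {ν : Measure β} [SFinite μ] [SFinite ν] {p : α → ℂ} {q : β → ℂ} (hp : MemLp p 2 μ)
    (hq : MemLp q 2 ν) : MemLp (fun z : α × β => p z.1 * q z.2) 2 (μ.prod ν) := by
  have hm : AEStronglyMeasurable (fun z : α × β => p z.1 * q z.2) (μ.prod ν) :=
    hp.1.comp_fst.mul hq.1.comp_snd
  rw [memLp_two_iff_integrable_sq_norm hm]
  have := ((memLp_two_iff_integrable_sq_norm hp.1).1 hp).mul_prod
    ((memLp_two_iff_integrable_sq_norm hq.1).1 hq)
  refine this.congr (.of_forall fun z => ?_)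
  simp only [norm_mul, mul_pow]

/-- The fibre integral `x ↦ ∫ F(x, t) φ(t) dt`. -/
noncomputable def fiberIntegral (ν : Measure T) (F : E × T → ℂ) (φ : T → ℂ) (x : E) : ℂ :=
  ∫ t, F (x, t) * φ t ∂ν

omit [NormedAddCommGroup E] [InnerProductSpace ℝ E] [FiniteDimensional ℝ E] [MeasurableSpace E]
  [BorelSpace E] [SigmaFinite ν] in
theorem fiberIntegral_mul (F : E × T → ℂ) (φ : T → ℂ) (ψ : E → ℂ) (x : E) :
    fiberIntegral ν F φ x * ψ x = ∫ t, F (x, t) * (ψ x * φ t) ∂ν := by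
  unfold fiberIntegral
  rw [← integral_mul_const]
  congr 1; ext t; ring

theorem integral_fiberIntegral_mul {F : E × T → ℂ} {φ : T → ℂ} {ψ : E → ℂ}
    (hF : MemLp F 2 (volume.prod ν)) (hφ : MemLp φ 2 ν) (hψ : MemLp ψ 2 volume) :
    Integrable (fun x => fiberIntegral ν F φ x * ψ x) ∧
      ∫ x, fiberIntegral ν F φ x * ψ x = ∫ z, F z * (ψ z.1 * φ z.2) ∂(volume.prod ν) := by
  have hi : Integrable (fun z : E × T => F z * (ψ z.1 * φ z.2)) (volume.prod ν) :=
    hF.integrable_mul (hψ.mul_tensor hφ)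
  simp only [fiberIntegral_mul]
  exact ⟨hi.integral_prod_left, (integral_prod _ hi).symm⟩

theorem memLp_two_exp_neg_mul_norm_sq {b : ℝ} (hb : 0 < b) :
    MemLp (fun y : E => ((Real.exp (-b * ‖y‖ ^ 2) : ℝ) : ℂ)) 2 volume := by
  rw [memLp_two_iff_integrable_sq_norm (Continuous.aestronglyMeasurable (by fun_prop))]
  refine (integrable_exp_neg_mul_norm_sq (E := E) (b := 2 * b) (by linarith)).congr
    (.of_forall fun y => ?_)
  simp only [Complex.norm_real, Real.norm_eq_abs, Real.abs_exp]
  rw [← Real.exp_nat_mul]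
  congr 1; push_cast; ring

open Set in
/-- Beurling's uncertainty principle for a function with an additional passive variable. -/
theorem beurling_prod_ae_eq_zero [Nontrivial E] {f F : E × T → ℂ} {w : T → ℝ}
    (hfm : StronglyMeasurable f) (hFm : StronglyMeasurable F)
    (hf : MemLp f 2 (volume.prod ν)) (hF : MemLp F 2 (volume.prod ν))
    (hwm : Measurable w) (hw0 : ∀ t, 0 < w t) (hw : MemLp (fun t => (w t : ℂ)) 2 ν)
    (hdual : ∀ (φ : T → ℂ), MemLp φ 2 ν → ∀ x : E,
      ∫ z, F z * ((Real.exp (-Real.pi * ‖z.1‖ ^ 2) *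
        Complex.exp (2 * Real.pi * Complex.I * (inner ℝ x z.1 : ℝ))) * φ z.2) ∂(volume.prod ν) =
      ∫ z, f z * (Real.exp (-Real.pi * ‖x - z.1‖ ^ 2) * φ z.2) ∂(volume.prod ν))
    (h : ∫⁻ z, ∫⁻ z', ENNReal.ofReal (‖f z‖ * w z.2) * ENNReal.ofReal (‖F z'‖ * w z'.2) *
      ENNReal.ofReal (Real.exp (2 * Real.pi * |inner ℝ z.1 z'.1|) /
        (1 + ‖z.1‖ + ‖z'.1‖) ^ Module.finrank ℝ E) ∂(volume.prod ν) ∂(volume.prod ν) < ⊤) :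
    F =ᵐ[volume.prod ν] 0 := by
  set κ : E → E → ENNReal := fun x y => ENNReal.ofReal (Real.exp (2 * Real.pi * |inner ℝ x y|) /
        (1 + ‖x‖ + ‖y‖) ^ Module.finrank ℝ E) with hκ
  have hκm : Measurable fun z : E × E => κ z.1 z.2 := by
    refine (Measurable.div ?_ ?_).ennreal_ofReal <;> exact Continuous.measurable (by fun_prop)
  -- The indicator of an arbitrary `A` is what later gives access to all rectangles; it only
  -- decreases the weight `w`.
  have hzero : ∀ A : Set T, MeasurableSet A →
      fiberIntegral ν F (A.indicator fun t => (w t : ℂ)) =ᵐ[volume] 0 := by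
    intro A hA
    set φ : T → ℂ := A.indicator fun t => (w t : ℂ) with hφ
    have hφL : MemLp φ 2 ν := hw.indicator hA
    have hφm : StronglyMeasurable φ :=
      (Complex.measurable_ofReal.comp hwm).stronglyMeasurable.indicator hA
    have hφw : ∀ t, ‖φ t‖ ≤ w t := fun t => by
      refine (norm_indicator_le_norm_self _ t).trans ?_
      rw [Complex.norm_real, Real.norm_eq_abs, abs_of_pos (hw0 t)]
    have hsm : ∀ {g : E × T → ℂ}, StronglyMeasurable g →
        StronglyMeasurable (fiberIntegral ν g φ) := fun hg =>
      StronglyMeasurable.integral_prod_right' (f := fun z : E × T => _ * φ z.2)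
        (hg.mul (hφm.comp_measurable measurable_snd))
    have hle : ∀ (g : E × T → ℂ) (x : E), ENNReal.ofReal ‖fiberIntegral ν g φ x‖ ≤
        ∫⁻ t, ENNReal.ofReal (‖g (x, t)‖ * w t) ∂ν := fun g x => by
      rw [ofReal_norm]
      refine (enorm_integral_le_lintegral_enorm _).trans (lintegral_mono fun t => ?_)
      rw [← ofReal_norm, norm_mul]
      gcongr
      exact hφw t
    refine beurling_ae_eq_zero (u := fiberIntegral ν f φ) (hsm hfm) (hsm hFm) ?_ ?_ ?_
    · refine (integral_fiberIntegral_mul hF hφL (memLp_two_exp_neg_mul_norm_sq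
        (half_pos Real.pi_pos))).1.norm.congr (.of_forall fun y => ?_)
      simp only [norm_mul, Complex.norm_real, Real.norm_eq_abs, Real.abs_exp]
    · intro x
      have hψ : MemLp (fun y : E => ((Real.exp (-Real.pi * ‖y‖ ^ 2) : ℝ) : ℂ) *
          Complex.exp (2 * Real.pi * Complex.I * (inner ℝ x y : ℝ))) 2 volume := by
        refine (memLp_two_exp_neg_mul_norm_sq Real.pi_pos).of_le
          (Continuous.aestronglyMeasurable (by fun_prop)) (.of_forall fun y => ?_)
        rw [norm_mul, Complex.norm_exp (2 * Real.pi * Complex.I * (inner ℝ x y : ℝ))]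
        simp
      have hψ' : MemLp (fun y : E => ((Real.exp (-Real.pi * ‖x - y‖ ^ 2) : ℝ) : ℂ)) 2 volume := by
        have := (memLp_two_exp_neg_mul_norm_sq (E := E) Real.pi_pos).comp_measurePreserving
          (measurePreserving_sub_right volume x)
        refine this.ae_eq (.of_forall fun y => ?_)
        simp [norm_sub_rev]
      have e : inverseFourierIntegral volume
          (fun y => fiberIntegral ν F φ y * Real.exp (-Real.pi * ‖y‖ ^ 2)) x =
          ∫ x', fiberIntegral ν f φ x' * (Real.exp (-Real.pi * ‖x - x'‖ ^ 2) : ℝ) := by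
        unfold inverseFourierIntegral
        simp only [mul_assoc (fiberIntegral ν F φ _)]
        rw [(integral_fiberIntegral_mul hF hφL hψ).2, hdual φ hφL x,
          ← (integral_fiberIntegral_mul hf hφL hψ').2]
      rw [e, ofReal_norm]
      refine (enorm_integral_le_lintegral_enorm _).trans (lintegral_mono fun x' => ?_)
      rw [enorm_mul, ← ofReal_norm, ← ofReal_norm, Complex.norm_real,
        Real.norm_eq_abs, Real.abs_exp]
    · have hfw : ∀ {g : E × T → ℂ}, StronglyMeasurable g →
          Measurable fun z : E × T => ENNReal.ofReal (‖g z‖ * w z.2) := fun hg =>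
        (hg.measurable.norm.mul (hwm.comp measurable_snd)).ennreal_ofReal
      have hin : ∀ x, ∫⁻ z' : E × T, ENNReal.ofReal (‖F z'‖ * w z'.2) * κ x z'.1 ∂(volume.prod ν) =
          ∫⁻ y, (∫⁻ t, ENNReal.ofReal (‖F (y, t)‖ * w t) ∂ν) * κ x y := fun x => by
        have hκx : Measurable fun z' : E × T => κ x z'.1 :=
          hκm.comp (f := fun z' : E × T => (x, z'.1)) (by fun_prop)
        rw [lintegral_prod (fun z' : E × T => ENNReal.ofReal (‖F z'‖ * w z'.2) * κ x z'.1)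
          ((hfw hFm).mul hκx).aemeasurable]
        refine lintegral_congr fun y => ?_
        exact lintegral_mul_const' (κ x y) _ ENNReal.ofReal_ne_top
      have hW : Measurable fun x => ∫⁻ z' : E × T, ENNReal.ofReal (‖F z'‖ * w z'.2) * κ x z'.1
          ∂(volume.prod ν) := by
        refine Measurable.lintegral_prod_right' (ν := volume.prod ν)
          (f := fun p : E × E × T => ENNReal.ofReal (‖F p.2‖ * w p.2.2) * κ p.1 p.2.1) ?_
        exact ((hfw hFm).comp measurable_snd).mul
          (hκm.comp (f := fun p : E × E × T => (p.1, p.2.1)) (by fun_prop))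
      refine lt_of_le_of_lt ?_ h
      calc _ ≤ ∫⁻ x, (∫⁻ t, ENNReal.ofReal (‖f (x, t)‖ * w t) ∂ν) *
            ∫⁻ z' : E × T, ENNReal.ofReal (‖F z'‖ * w z'.2) * κ x z'.1 ∂(volume.prod ν) := by
            refine lintegral_mono fun x => ?_
            rw [hin]
            refine (lintegral_congr fun y => mul_assoc _ _ (κ x y)).trans_le ?_
            rw [lintegral_const_mul' _ _ ENNReal.ofReal_ne_top]
            refine mul_le_mul' (hle f x) (lintegral_mono fun y => ?_)
            exact mul_le_mul' (hle F y) le_rfl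
        _ = ∫⁻ z : E × T, ENNReal.ofReal (‖f z‖ * w z.2) *
            (∫⁻ z' : E × T, ENNReal.ofReal (‖F z'‖ * w z'.2) * κ z.1 z'.1 ∂(volume.prod ν))
              ∂(volume.prod ν) := by
            rw [lintegral_prod (fun z : E × T => ENNReal.ofReal (‖f z‖ * w z.2) *
              ∫⁻ z' : E × T, ENNReal.ofReal (‖F z'‖ * w z'.2) * κ z.1 z'.1 ∂(volume.prod ν))
              ((hfw hfm).mul (hW.comp measurable_fst)).aemeasurable]
            refine lintegral_congr fun x => ?_
            exact (lintegral_mul_const _ ((hfw hfm).comp measurable_prodMk_left)).symm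
        _ = _ := by
            refine lintegral_congr fun z => ?_
            rw [← lintegral_const_mul' _ _ ENNReal.ofReal_ne_top]
            exact lintegral_congr fun z' => (mul_assoc _ _ _).symm
  -- `F` is only square integrable; multiplying by the nowhere zero square-integrable function `γ ⊗
  -- w` makes it integrable without losing zeros.
  set γ : E → ℂ := fun y => ((Real.exp (-Real.pi * ‖y‖ ^ 2) : ℝ) : ℂ) with hγ
  have hγL : MemLp γ 2 volume := memLp_two_exp_neg_mul_norm_sq Real.pi_pos
  have hi : Integrable (fun z : E × T => F z * (γ z.1 * (w z.2 : ℂ))) (volume.prod ν) :=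
    hF.integrable_mul (hγL.mul_tensor hw)
  have hrect : ∀ (S : Set E) (A : Set T), MeasurableSet S → MeasurableSet A →
      ∫ z in S ×ˢ A, F z * (γ z.1 * (w z.2 : ℂ)) ∂(volume.prod ν) = 0 := by
    intro S A hS hA
    rw [← integral_indicator (hS.prod hA)]
    have h1 := (integral_fiberIntegral_mul hF (hw.indicator hA) (hγL.indicator hS)).2
    have h2 : ∀ z : E × T, (S ×ˢ A).indicator (fun z => F z * (γ z.1 * (w z.2 : ℂ))) z =
        F z * (S.indicator γ z.1 * A.indicator (fun t => (w t : ℂ)) z.2) := fun z => by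
      by_cases hz1 : z.1 ∈ S <;> by_cases hz2 : z.2 ∈ A <;> simp [indicator, hz1, hz2]
    simp only [h2]
    rw [← h1, ← integral_zero E ℂ]
    refine integral_congr_ae ((hzero A hA).mono fun y hy => ?_)
    simp only [hy, Pi.zero_apply, zero_mul]
  have hre := Integrable.ae_eq_zero_of_setIntegral_prod_eq_zero hi.re fun S A hS hA => by
    rw [integral_re hi.restrict, hrect S A hS hA, map_zero]
  have him := Integrable.ae_eq_zero_of_setIntegral_prod_eq_zero hi.im fun S A hS hA => by
    rw [integral_im hi.restrict, hrect S A hS hA, map_zero]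
  filter_upwards [hre, him] with z h1 h2
  have h3 : F z * (γ z.1 * (w z.2 : ℂ)) = 0 := Complex.ext h1 h2
  have h4 : γ z.1 ≠ 0 := Complex.ofReal_ne_zero.2 (Real.exp_ne_zero _)
  have h5 : (w z.2 : ℂ) ≠ 0 := Complex.ofReal_ne_zero.2 (hw0 _).ne'
  exact (mul_eq_zero.1 h3).resolve_right (mul_ne_zero h4 h5)

end Product

/-! ### The splitting of `ℝᵈ` and duality for the partial transform. -/

/-- The space of the last `d - k` coordinates of `ℝᵈ`. -/
abbrev TailSpace (d k : ℕ) : Type := EuclideanSpace ℝ {i : Fin d // ¬ (i : ℕ) < k}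

theorem replaceHead_eq_dite {d : ℕ} (k : ℕ) (y : HeadSpace d k)
    (x₂ : {i : Fin d // ¬ (i : ℕ) < k} → ℝ) :
    replaceHead k y (WithLp.toLp 2 fun i : Fin d => if h : (i : ℕ) < k then 0 else x₂ ⟨i, h⟩) =
      WithLp.toLp 2 fun i : Fin d => if h : (i : ℕ) < k then y ⟨i, h⟩ else x₂ ⟨i, h⟩ := by
  ext i
  by_cases h : (i : ℕ) < k <;> simp [replaceHead, h]

/-- The identification `ℝᵏ × ℝᵈ⁻ᵏ ≃ ℝᵈ`. -/
noncomputable def joinEquiv (d k : ℕ) : HeadSpace d k × TailSpace d k ≃ᵐ RSpace d where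
  toFun z := WithLp.toLp 2 fun i : Fin d => if h : (i : ℕ) < k then z.1 ⟨i, h⟩ else z.2 ⟨i, h⟩
  invFun ω := (headPart k ω, WithLp.toLp 2 fun i => ω i.1)
  left_inv z := by
    ext i
    · simp [headPart, i.2]
    · simp [i.2]
  right_inv ω := by
    ext i
    by_cases h : (i : ℕ) < k <;> simp [headPart, h]
  measurable_toFun := by
    refine (WithLp.measurable_toLp 2 _).comp (measurable_pi_lambda _ fun i => ?_)
    by_cases h : (i : ℕ) < k
    · simp only [h, dif_pos]; fun_prop
    · simp only [h, dif_neg, not_false_eq_true]; fun_prop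
  measurable_invFun := by
    refine Measurable.prodMk ?_ ?_ <;>
    exact (WithLp.measurable_toLp 2 _).comp (measurable_pi_lambda _ fun i => by fun_prop)

section Join

variable {d k : ℕ}

theorem joinEquiv_apply (z : HeadSpace d k × TailSpace d k) : joinEquiv d k z =
    WithLp.toLp 2 fun i : Fin d => if h : (i : ℕ) < k then z.1 ⟨i, h⟩ else z.2 ⟨i, h⟩ := rfl

theorem measurePreserving_joinEquiv :
    MeasurePreserving (joinEquiv d k) (volume.prod volume) volume := by
  refine ⟨(joinEquiv d k).measurable, Measure.ext fun s hs => ?_⟩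
  rw [Measure.map_apply (joinEquiv d k).measurable hs, ← lintegral_indicator_one hs,
    lintegral_eq_lintegral_replaceHead k _ (measurable_one.indicator hs),
    ← lintegral_indicator_one ((joinEquiv d k).measurable hs),
    lintegral_prod_symm' _ (measurable_one.indicator ((joinEquiv d k).measurable hs))]
  have hm : Measurable fun t : TailSpace d k => ∫⁻ y : HeadSpace d k,
      (joinEquiv d k ⁻¹' s).indicator (1 : HeadSpace d k × TailSpace d k → ENNReal) (y, t) :=
    Measurable.lintegral_prod_left' (measurable_one.indicator ((joinEquiv d k).measurable hs))
  rw [← (PiLp.volume_preserving_toLp _).lintegral_comp hm]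
  simp only [replaceHead_eq_dite]
  rfl

theorem inner_joinEquiv (z z' : HeadSpace d k × TailSpace d k) :
    inner ℝ (joinEquiv d k z) (joinEquiv d k z') = inner ℝ z.1 z'.1 + inner ℝ z.2 z'.2 := by
  simp only [PiLp.inner_apply]
  rw [← Fintype.sum_subtype_add_sum_subtype (fun i : Fin d => (i : ℕ) < k)]
  congr 1 <;> refine Finset.sum_congr rfl fun i _ => ?_ <;> simp [joinEquiv_apply, i.2]

theorem norm_joinEquiv_le (z : HeadSpace d k × TailSpace d k) :
    ‖joinEquiv d k z‖ ≤ ‖z.1‖ + ‖z.2‖ := by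
  refine abs_le_of_sq_le_sq' ?_ (by positivity) |>.2
  rw [← real_inner_self_eq_norm_sq, inner_joinEquiv, real_inner_self_eq_norm_sq,
    real_inner_self_eq_norm_sq]
  nlinarith [norm_nonneg z.1, norm_nonneg z.2, mul_nonneg (norm_nonneg z.1) (norm_nonneg z.2)]

open FourierTransform in
/-- On each slice the partial Fourier integral of a Schwartz function is a Fourier transform. -/
theorem exists_schwartz_fourier_slice (g : 𝓢(RSpace d, ℂ)) (t : TailSpace d k) :
    ∃ ψ : 𝓢(HeadSpace d k, ℂ), (∀ y, ψ y = g (joinEquiv d k (y, t))) ∧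
      ∀ y, partialFourierIntegral k g (joinEquiv d k (y, t)) = 𝓕 (ψ : HeadSpace d k → ℂ) y := by
  obtain ⟨ψ, hψ⟩ := exists_schwartz_slice k g (joinEquiv d k (0, t))
  have e : ∀ y y', replaceHead k y' (joinEquiv d k (y, t)) = joinEquiv d k (y', t) := fun y y' => by
    ext i; by_cases h : (i : ℕ) < k <;> simp [replaceHead, joinEquiv_apply, h]
  simp only [e] at hψ
  refine ⟨ψ, hψ, fun y => ?_⟩
  have e1 : headPart k (joinEquiv d k (y, t)) = y := by
    ext i; simp [headPart, joinEquiv_apply, i.2]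
  rw [Real.fourier_eq', partialFourierIntegral]
  refine integral_congr_ae (.of_forall fun y' => ?_)
  simp only [e1, e, hψ, smul_eq_mul]
  rw [mul_comm, real_inner_comm]
  congr 2
  push_cast
  ring

theorem integrable_cexp_neg_pi_norm_sq_mul {E : Type*} [NormedAddCommGroup E]
    [InnerProductSpace ℝ E] [FiniteDimensional ℝ E] [MeasurableSpace E] [BorelSpace E] (x : E) :
    Integrable fun y : E => ((Real.exp (-Real.pi * ‖y‖ ^ 2) : ℝ) : ℂ) *
      Complex.exp (2 * Real.pi * Complex.I * (inner ℝ x y : ℝ)) := by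
  refine (integrable_exp_neg_mul_norm_sq Real.pi_pos).mono'
    (Continuous.aestronglyMeasurable (by fun_prop)) (.of_forall fun y => ?_)
  rw [norm_mul, Complex.norm_exp (2 * Real.pi * Complex.I * (inner ℝ x y : ℝ)), Complex.norm_real]
  simp

open FourierTransform in
theorem fourier_modulated_gaussian {E : Type*} [NormedAddCommGroup E]
    [InnerProductSpace ℝ E] [FiniteDimensional ℝ E] [MeasurableSpace E] [BorelSpace E] (x w : E) :
    𝓕 (fun y : E => ((Real.exp (-Real.pi * ‖y‖ ^ 2) : ℝ) : ℂ) *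
      Complex.exp (2 * Real.pi * Complex.I * (inner ℝ x y : ℝ))) w =
        (Real.exp (-Real.pi * ‖x - w‖ ^ 2) : ℝ) := by
  have h := fourier_gaussian_innerProductSpace' (V := E) (b := Real.pi)
    (by simpa using Real.pi_pos) x w
  have hpi : (Real.pi : ℂ) ≠ 0 := Complex.ofReal_ne_zero.2 Real.pi_ne_zero
  rw [div_self hpi, Complex.one_cpow, one_mul] at h
  convert! h using 2
  · ext y
    rw [Complex.exp_add]
    push_cast
    rfl
  · push_cast
    congr 1
    field_simp

open FourierTransform in
theorem integral_fourier_mul_gaussian {E : Type*} [NormedAddCommGroup E]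
    [InnerProductSpace ℝ E] [FiniteDimensional ℝ E] [MeasurableSpace E] [BorelSpace E]
    (ψ : 𝓢(E, ℂ)) (x : E) :
    ∫ y, 𝓕 (ψ : E → ℂ) y * (((Real.exp (-Real.pi * ‖y‖ ^ 2) : ℝ) : ℂ) *
      Complex.exp (2 * Real.pi * Complex.I * (inner ℝ x y : ℝ))) =
    ∫ y, ψ y * (Real.exp (-Real.pi * ‖x - y‖ ^ 2) : ℝ) := by
  have h := VectorFourier.integral_fourierIntegral_smul_eq_flip (L := innerₗ E) (μ := volume)
    (ν := volume) (e := Real.fourierChar) (f := ψ) Real.continuous_fourierChar continuous_inner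
    ψ.integrable (integrable_cexp_neg_pi_norm_sq_mul x)
  simp only [smul_eq_mul] at h
  refine h.trans (integral_congr_ae (.of_forall fun y => ?_))
  simp only
  rw [← fourier_modulated_gaussian x y, flip_innerₗ]
  rfl

/-- Pairing an `L²` function with a fixed `L²` function is continuous. -/
theorem continuous_integral_mul_memLp {α : Type*} [MeasurableSpace α] {μ : Measure α} {Φ : α → ℂ}
    (hΦ : MemLp Φ 2 μ) : Continuous fun f : Lp ℂ 2 μ => ∫ ω, f ω * Φ ω ∂μ := by
  have h : ∀ f : Lp ℂ 2 μ, ∫ ω, f ω * Φ ω ∂μ = inner ℂ (hΦ.star.toLp (star Φ)) f := fun f => by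
    rw [L2.inner_def]
    refine integral_congr_ae (hΦ.star.coeFn_toLp.mono fun ω hω => ?_)
    simp [hω]
  simp only [h]
  fun_prop

/-- The multiplication formula for the partial Fourier transform against modulated Gaussians. -/
theorem integral_partialFourier_mul (f : Lp ℂ 2 (volume : Measure (RSpace d)))
    {φ : TailSpace d k → ℂ} (hφ : MemLp φ 2 volume) (x : HeadSpace d k) :
    ∫ z, partialFourier d k f (joinEquiv d k z) * ((Real.exp (-Real.pi * ‖z.1‖ ^ 2) *
        Complex.exp (2 * Real.pi * Complex.I * (inner ℝ x z.1 : ℝ))) * φ z.2)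
          ∂(volume.prod volume) =
      ∫ z, f (joinEquiv d k z) * (Real.exp (-Real.pi * ‖x - z.1‖ ^ 2) * φ z.2)
        ∂(volume.prod volume) := by
  have hψ : MemLp (fun y : HeadSpace d k => ((Real.exp (-Real.pi * ‖y‖ ^ 2) : ℝ) : ℂ) *
      Complex.exp (2 * Real.pi * Complex.I * (inner ℝ x y : ℝ))) 2 volume := by
    refine (memLp_two_exp_neg_mul_norm_sq Real.pi_pos).of_le
      (Continuous.aestronglyMeasurable (by fun_prop)) (.of_forall fun y => ?_)
    rw [norm_mul, Complex.norm_exp (2 * Real.pi * Complex.I * (inner ℝ x y : ℝ))]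
    simp
  have hψ' : MemLp (fun y : HeadSpace d k => ((Real.exp (-Real.pi * ‖x - y‖ ^ 2) : ℝ) : ℂ)) 2
      volume := by
    refine ((memLp_two_exp_neg_mul_norm_sq Real.pi_pos).comp_measurePreserving
      (measurePreserving_sub_right volume x)).ae_eq (.of_forall fun y => ?_)
    simp [norm_sub_rev]
  have hmp := measurePreserving_joinEquiv (d := d) (k := k)
  have hmps := hmp.symm (joinEquiv d k)
  set Φ := fun z : HeadSpace d k × TailSpace d k => (((Real.exp (-Real.pi * ‖z.1‖ ^ 2) : ℝ) : ℂ) *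
        Complex.exp (2 * Real.pi * Complex.I * (inner ℝ x z.1 : ℝ))) * φ z.2 with hΦdef
  set Ψ := fun z : HeadSpace d k × TailSpace d k =>
    ((Real.exp (-Real.pi * ‖x - z.1‖ ^ 2) : ℝ) : ℂ) * φ z.2 with hΨdef
  have hΦ : MemLp Φ 2 (volume.prod volume) := hψ.mul_tensor hφ
  have hΨ : MemLp Ψ 2 (volume.prod volume) := hψ'.mul_tensor hφ
  have htrans : ∀ (g : RSpace d → ℂ) (Θ : HeadSpace d k × TailSpace d k → ℂ),
      ∫ z, g (joinEquiv d k z) * Θ z ∂(volume.prod volume) =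
        ∫ ω, g ω * (Θ ∘ (joinEquiv d k).symm) ω := fun g Θ => by
    rw [← hmp.integral_comp']
    simp
  rw [htrans, htrans]
  have hΦ' := hΦ.comp_measurePreserving hmps
  have hΨ' := hΨ.comp_measurePreserving hmps
  have hd : DenseRange (SchwartzMap.toLpCLM ℂ (E := RSpace d) ℂ 2 volume) :=
    SchwartzMap.denseRange_toLpCLM ENNReal.ofNat_ne_top
  -- Both sides are continuous in `f` for the `L²` norm, so Schwartz functions suffice; there Fubini
  -- reduces the identity to the full Fourier transform on each slice.
  refine hd.induction_on f (isClosed_eq ((continuous_integral_mul_memLp hΦ').comp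
    (partialFourier d k).continuous) (continuous_integral_mul_memLp hΨ')) fun g => ?_
  rw [SchwartzMap.toLpCLM_apply, partialFourier_toLp]
  have h1 : ∫ ω, (memLp_partialFourierIntegral k g).toLp (partialFourierIntegral k g) ω *
      (Φ ∘ (joinEquiv d k).symm) ω =
        ∫ z, partialFourierIntegral k g (joinEquiv d k z) * Φ z ∂(volume.prod volume) := by
    rw [htrans]
    refine integral_congr_ae ((memLp_partialFourierIntegral k g).coeFn_toLp.mono fun ω hω => ?_)
    simp only [hω]
  have h2 : ∫ ω, g.toLp 2 volume ω * (Ψ ∘ (joinEquiv d k).symm) ω =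
        ∫ z, g (joinEquiv d k z) * Ψ z ∂(volume.prod volume) := by
    rw [htrans]
    refine integral_congr_ae ((g.coeFn_toLp 2 volume).mono fun ω hω => ?_)
    simp only [hω]
  rw [h1, h2, integral_prod_symm, integral_prod_symm]
  · refine integral_congr_ae (.of_forall fun t => ?_)
    obtain ⟨ψ, hψ1, hψ2⟩ := exists_schwartz_fourier_slice g t
    simp only [hψ2, ← hψ1, hΦdef, hΨdef, ← mul_assoc]
    rw [integral_mul_const, integral_mul_const, ← integral_fourier_mul_gaussian]
    simp only [mul_assoc]
  · exact ((g.memLp 2 volume).comp_measurePreserving hmp).integrable_mul hΨ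
  · exact ((memLp_partialFourierIntegral k g).comp_measurePreserving hmp).integrable_mul hΦ

/-! ### Absorbing the passive variables, and the conclusion. -/

/-- The weight in the passive variables. -/
noncomputable def tailWeight (k : ℕ) {T : Type*} [NormedAddCommGroup T] (t : T) : ℝ :=
  Real.exp (-Real.pi * ‖t‖ ^ 2) / (1 + ‖t‖) ^ k

/-- By Cauchy-Schwarz the passive inner product costs at most `e^{2π‖t‖‖t'‖}`, which the two
Gaussians absorb since `2‖t‖‖t'‖ ≤ ‖t‖² + ‖t'‖²`. The powers in `tailWeight` split the joint
denominator, and `N ≤ k` raises its exponent because the base is at least one. -/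
theorem beurling_weight_le {N : ℝ} (hN : N ≤ (k : ℝ)) (z z' : HeadSpace d k × TailSpace d k) :
    tailWeight k z.2 * tailWeight k z'.2 *
      (Real.exp (2 * Real.pi * |inner ℝ z.1 z'.1|) / (1 + ‖z.1‖ + ‖z'.1‖) ^ k) ≤
      Real.exp (2 * Real.pi * |inner ℝ (joinEquiv d k z) (joinEquiv d k z')|) /
        (1 + ‖joinEquiv d k z‖ + ‖joinEquiv d k z'‖) ^ N := by
  have hz := norm_joinEquiv_le z
  have hz' := norm_joinEquiv_le z'
  have h1 : (1 + ‖joinEquiv d k z‖ + ‖joinEquiv d k z'‖) ^ N ≤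
      ((1 + ‖z.2‖) * (1 + ‖z'.2‖) * (1 + ‖z.1‖ + ‖z'.1‖)) ^ k := by
    refine (Real.rpow_le_rpow_of_exponent_le (by
      linarith [norm_nonneg (joinEquiv d k z), norm_nonneg (joinEquiv d k z')]) hN).trans ?_
    rw [Real.rpow_natCast]
    gcongr
    have := norm_nonneg z.1
    have := norm_nonneg z.2
    have := norm_nonneg z'.1
    have := norm_nonneg z'.2
    have : 0 ≤ ‖z.2‖ * ‖z'.2‖ := by positivity
    have : 0 ≤ (‖z.2‖ + ‖z'.2‖ + ‖z.2‖ * ‖z'.2‖) * (‖z.1‖ + ‖z'.1‖) := by positivity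
    linarith
  have h2 : Real.exp (-Real.pi * ‖z.2‖ ^ 2) * Real.exp (-Real.pi * ‖z'.2‖ ^ 2) *
      Real.exp (2 * Real.pi * |inner ℝ z.1 z'.1|) ≤
      Real.exp (2 * Real.pi * |inner ℝ (joinEquiv d k z) (joinEquiv d k z')|) := by
    rw [← Real.exp_add, ← Real.exp_add, inner_joinEquiv]
    refine Real.exp_le_exp.2 ?_
    have h3 : |inner ℝ z.1 z'.1| ≤ |inner ℝ z.1 z'.1 + inner ℝ z.2 z'.2| + ‖z.2‖ * ‖z'.2‖ := by
      have := abs_sub_abs_le_abs_add (inner ℝ z.1 z'.1) (inner ℝ z.2 z'.2)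
      have := abs_real_inner_le_norm z.2 z'.2
      linarith
    have h4 : 2 * (‖z.2‖ * ‖z'.2‖) ≤ ‖z.2‖ ^ 2 + ‖z'.2‖ ^ 2 := by
      nlinarith [sq_nonneg (‖z.2‖ - ‖z'.2‖)]
    have h5 := mul_le_mul_of_nonneg_left h3 Real.two_pi_pos.le
    have h6 := mul_le_mul_of_nonneg_left h4 Real.pi_pos.le
    linarith
  calc _ = Real.exp (-Real.pi * ‖z.2‖ ^ 2) * Real.exp (-Real.pi * ‖z'.2‖ ^ 2) *
      Real.exp (2 * Real.pi * |inner ℝ z.1 z'.1|) /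
        ((1 + ‖z.2‖) * (1 + ‖z'.2‖) * (1 + ‖z.1‖ + ‖z'.1‖)) ^ k := by
        unfold tailWeight
        rw [mul_pow, mul_pow]
        ring
    _ ≤ _ := by gcongr

theorem memLp_tailWeight : MemLp (fun t : TailSpace d k => (tailWeight k t : ℂ)) 2 volume := by
  refine (memLp_two_exp_neg_mul_norm_sq Real.pi_pos).of_le (Continuous.aestronglyMeasurable ?_)
    (.of_forall fun t => ?_)
  · refine Complex.continuous_ofReal.comp ?_
    unfold tailWeight
    exact Continuous.div (by fun_prop) (by fun_prop) fun t => by positivity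
  · unfold tailWeight
    rw [Complex.norm_real, Complex.norm_real, norm_div]
    refine div_le_self (norm_nonneg _) ?_
    rw [norm_pow, Real.norm_eq_abs, abs_of_nonneg (by positivity)]
    exact one_le_pow₀ (by linarith [norm_nonneg t])

theorem finrank_headSpace (hkd : k ≤ d) : Module.finrank ℝ (HeadSpace d k) = k := by
  rw [finrank_euclideanSpace, Fintype.card_subtype]
  have : (Finset.univ.filter fun i : Fin d => (i : ℕ) < k) =
      Finset.univ.map (Fin.castLEEmb hkd) := by
    ext i
    simp only [Finset.mem_filter, Finset.mem_univ, true_and, Finset.mem_map, Fin.castLEEmb_apply]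
    exact ⟨fun h => ⟨⟨i, h⟩, rfl⟩, by rintro ⟨j, rfl⟩; exact j.2⟩
  rw [this, Finset.card_map, Finset.card_univ, Fintype.card_fin]

end Join

theorem theorem5p2 (d k : ℕ) (hk : 1 ≤ k) (hkd : k ≤ d) (N : ℝ) (hN : 0 ≤ N) (hNk : N ≤ (k : ℝ))
    (f : Lp ℂ 2 (volume : Measure (RSpace d)))
    (hf : ∫⁻ z : RSpace d × RSpace d,
      ENNReal.ofReal (‖f z.1 * partialFourier d k f z.2‖ / (1 + ‖z.1‖ + ‖z.2‖) ^ N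
        * Real.exp (2 * Real.pi * |inner ℝ z.1 z.2|)) < ⊤) :
    f = 0 := by
  have hmp := measurePreserving_joinEquiv (d := d) (k := k)
  have hrank := finrank_headSpace hkd
  have : Nontrivial (HeadSpace d k) := Module.nontrivial_of_finrank_pos (R := ℝ) (by omega)
  have hfm := Lp.stronglyMeasurable f
  have hFm := Lp.stronglyMeasurable (partialFourier d k f)
  have hzero := beurling_prod_ae_eq_zero (E := HeadSpace d k) (T := TailSpace d k) (ν := volume)
    (f := f ∘ joinEquiv d k) (F := partialFourier d k f ∘ joinEquiv d k) (w := tailWeight k)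
    (hfm.comp_measurable (joinEquiv d k).measurable)
    (hFm.comp_measurable (joinEquiv d k).measurable)
    ((Lp.memLp f).comp_measurePreserving hmp)
    ((Lp.memLp (partialFourier d k f)).comp_measurePreserving hmp)
    (Measurable.div (by fun_prop) (by fun_prop)) (fun t => by unfold tailWeight; positivity)
    memLp_tailWeight (fun φ hφ x => integral_partialFourier_mul f hφ x) ?_
  · have hF0 : partialFourier d k f =ᵐ[volume] 0 := by
      have h1 := (hmp.symm (joinEquiv d k)).quasiMeasurePreserving.ae hzero
      filter_upwards [h1] with ω hω
      simpa using hω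
    have h2 : partialFourier d k f = 0 := (Lp.eq_zero_iff_ae_eq_zero).2 hF0
    -- The vanishing of `𝓕ₖ f` passes to `f` by Plancherel.
    rw [← norm_eq_zero, ← norm_partialFourier d k f, h2, norm_zero]
  · rw [hrank]
    have hmeas : Measurable fun z : RSpace d × RSpace d =>
        ENNReal.ofReal (‖f z.1 * partialFourier d k f z.2‖ / (1 + ‖z.1‖ + ‖z.2‖) ^ N
          * Real.exp (2 * Real.pi * |inner ℝ z.1 z.2|)) := by
      have := hfm.measurable
      have := hFm.measurable
      refine (Measurable.mul (Measurable.div ?_ ?_) ?_).ennreal_ofReal <;> fun_prop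
    rw [Measure.volume_eq_prod, lintegral_prod _ hmeas.aemeasurable,
      ← hmp.lintegral_comp hmeas.lintegral_prod_right'] at hf
    refine lt_of_le_of_lt (lintegral_mono fun z => (lintegral_mono fun z' => ?_).trans_eq
      (hmp.lintegral_comp (hmeas.comp (measurable_prodMk_left (x := joinEquiv d k z))))) hf
    have hw : ∀ t : TailSpace d k, 0 ≤ tailWeight k t := fun t => by
      unfold tailWeight; positivity
    have h1 := hw z.2
    have h2 := hw z'.2
    rw [← ENNReal.ofReal_mul (by positivity), ← ENNReal.ofReal_mul (by positivity)]
    refine ENNReal.ofReal_le_ofReal ?_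
    have h3 := mul_le_mul_of_nonneg_left (beurling_weight_le hNk z z')
      (norm_nonneg (f (joinEquiv d k z) * partialFourier d k f (joinEquiv d k z')))
    refine le_trans (le_of_eq ?_) (h3.trans (le_of_eq ?_))
    · rw [norm_mul]
      simp only [Function.comp_apply]
      ring
    · rw [mul_div_assoc', div_mul_eq_mul_div]
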